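/- Let $q,m,n,a$ be positive integers with $q\ge 2$ and $\gcd(a,q)=1$. For integers $b$, put $$V_{\chi,q}(m,n;a,b)=\sum_{\substack{\chi\ (\mathrm{mod}\ q)\\ \chi(-1)=(-1)^m=(-1)^n}}\chi(a)\,\overline{\chi}(b)\,L(m,\chi)\,L(n,\overline{\chi}),$$ where $\chi$ runs over the Dirichlet characters modulo $q$ and $L(s,\chi)$ is the Dirichlet $L$-function (the sum is empty, hence $0$, if $m\not\equiv n \pmod 2$). Let $\overline{B}_k(x)=B_k(\{x\})$ be the $k$-th Bernoulli function, where $B_k(x)$ is the Bernoulli polynomial and $\{x\}$ the fractional part of $x$, except that $\overline{B}_1(x)=0$ for $x\in\mathbb{Z}$; let $B_k$ be the $k$-th Bernoulli number, $\phi$ Euler's totient function, $\mu$ the Möbius function, $\delta$ the Kronecker delta, and $J_k(q)=q^k\prod_{p\mid q}(1-p^{-k})$ Jordan's totient function, the product being over the primes dividing $q$. Then $$\begin{aligned}V_{\chi,q}(m,n;a,1)=\frac{(-1)^{\frac{m-n}{2}}(2\pi)^{m+n}\phi(q)}{4q^{m+n}\,m!\,n!}\Biggl(&n\sum_{j=1}^{m}\binom{m}{j}\frac{(-1)^{j}a^{m-j}}{m+n-j}\,\overline{B}_{j}(0)\,\overline{B}_{m+n-j}(0)\,J_{j}(q)\\&+m\,a^{m-1}\sum_{j=1}^{n}\binom{n}{j}\frac{(-1)^{j}}{m+n-j}\sum_{l=1}^{a}\overline{B}_{j}\Bigl(\frac{l}{a}\Bigr)\sum_{d\mid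 q}\mu\Bigl(\frac{q}{d}\Bigr)d^{j}\,\overline{B}_{m+n-j}\Bigl(\frac{dl}{a}\Bigr)\\&+\frac{(-1)^{n-1}m!\,n!\,B_{m+n}\,J_{m+n}(q)}{a^{n}(m+n)!}-\delta_{1,m}\delta_{1,n}\frac{\phi(q)}{4}\Biggr),\end{aligned}$$ where $(-1)^{\frac{m-n}{2}}=e^{\pi\mathrm{i}(m-n)/2}$. -/

import Mathlib

noncomputable section

/-- The `n`-th Bernoulli function `B̄ₙ`: the 1-periodic function equal to `Bₙ({x})`, where `{x}` is
the fractional part, except that `B̄₁` vanishes at the integers. -/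
def bernoulliBar (n : ℕ) (x : ℝ) : ℝ :=
  if n = 1 ∧ Int.fract x = 0 then 0 else bernoulliFun n (Int.fract x)

/-- Jordan's totient function `J_n(q) = q ^ n * ∏_{p ∣ q, p prime} (1 - 1 / p ^ n)`. -/
def jordanTotient (n q : ℕ) : ℝ :=
  (q : ℝ) ^ n * ∏ p ∈ q.primeFactors, (1 - 1 / (p : ℝ) ^ n)

open scoped Classical in
/-- `V_{χ,q}(m, n; a, b)`: the sum of `χ(a) χ̄(b) L(m, χ) L(n, χ̄)` over the Dirichlet characters `χ`
modulo `q` with `χ(-1) = (-1)^m = (-1)^n`; `star χ` is the complex conjugate character. In the range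
`m, n ≥ 1`, the value `L(1, χ)` enters only for odd, hence non-principal, characters. -/
def characterMean (q : ℕ) [NeZero q] (m n : ℕ) (a b : ℤ) : ℂ :=
  ∑ χ : DirichletCharacter ℂ q with χ (-1) = (-1) ^ m ∧ χ (-1) = (-1) ^ n,
    χ (a : ZMod q) * (star χ) (b : ZMod q) *
      DirichletCharacter.LFunction χ (m : ℂ) * DirichletCharacter.LFunction (star χ) (n : ℂ)

end

/-! Write D_k(r) for the discrete Fourier transform modulo q of h ↦ B̄_k(h/q). If χ(-1) = (-1)^m,
the Fourier series of B̄_m makes L(m, χ) an explicit constant times ∑_r χ(r) D_m(r)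
(`LFunction_natCast_eq`; for m = 1 through a cotangent sum). For χ of the other parity that sum is
zero, so the parity condition can be dropped and the mean taken over all characters. Orthogonality
leaves φ(q) ∑_u D_m(u) D_n(au) over the units u (`characterMean_eq`). No case distinction on m - n
is needed: for opposite parities every summand vanishes.

Möbius inversion removes the coprimality condition. On multiples of q/d the multiplication theorem
lowers D_k from level q to level d, and Parseval turns the sum over residues modulo d into the
generalized Dedekind sum ∑_c B̄_m(ac/d) B̄_n(c/d) (`sum_units_bernoulliDFT_mul`).

The Dedekind sums are evaluated by reciprocity (`dedekindSum_reciprocity`). A product formula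
expands B̄_m(x+y) B̄_n(x) into products in which each factor depends on only one of the pairs (y,
x+y) or (y, x). Summing it over x = c/d, y = l/a and collapsing with the multiplication theorem
gives the law. Weighting by μ(q/d) produces Jordan totients, and the j = 0 terms drop out since
∑_{d∣q} μ(q/d) = 0 for q ≥ 2. The term with δ_{1,m} δ_{1,n} comes from the jumps of B̄_1 at
integers. -/

/-! ### Product formula for Bernoulli polynomials. -/

section

open Finset

/-- The Bernoulli polynomial `B_k(x)` divided by `k!`, as a real function. -/
noncomputable def normBernoulli (k : ℕ) (x : ℝ) : ℝ := bernoulliFun k x / k.factorial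

theorem normBernoulli_zero (x : ℝ) : normBernoulli 0 x = 1 := by simp [normBernoulli]

theorem hasDerivAt_normBernoulli_succ (k : ℕ) (x : ℝ) :
    HasDerivAt (normBernoulli (k + 1)) (normBernoulli k x) x := by
  have h := (hasDerivAt_bernoulliFun (k + 1) x).div_const ((k + 1).factorial : ℝ)
  refine h.congr_deriv ?_
  have : (k.factorial : ℝ) ≠ 0 := by positivity
  have : (k + 1 : ℝ) ≠ 0 := by positivity
  rw [Nat.factorial_succ, normBernoulli]
  push_cast
  field_simp

theorem normBernoulli_eval_one (k : ℕ) :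
    normBernoulli k 1 = normBernoulli k 0 + if k = 1 then 1 else 0 := by
  rw [normBernoulli, normBernoulli, bernoulliFun_eval_one]
  split_ifs with h
  · subst h; simp
  · simp

theorem normBernoulli_one_sub (k : ℕ) (x : ℝ) :
    normBernoulli k (1 - x) = (-1) ^ k * normBernoulli k x := by
  rw [normBernoulli, normBernoulli, bernoulliFun_eval_one_sub, mul_div_assoc]

/-- `∑_{i + j = n} (± 1) ^ j * multichoose m i * β_j(y) * β_{m+i}(z)`, where `β_k = B_k / k!`. -/
noncomputable def bernoulliConv (ε : ℝ) (m n : ℕ) (y z : ℝ) : ℝ :=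
  ∑ p ∈ antidiagonal n, ε ^ p.2 * (m.multichoose p.1 : ℝ) * normBernoulli p.2 y *
    normBernoulli (m + p.1) z

theorem bernoulliConv_zero_left (ε : ℝ) (n : ℕ) (y z : ℝ) :
    bernoulliConv ε 0 n y z = ε ^ n * normBernoulli n y := by
  rw [bernoulliConv, Finset.Nat.sum_antidiagonal_eq_sum_range_succ_mk, sum_range_succ']
  simp [normBernoulli_zero]

theorem bernoulliConv_zero_right (ε : ℝ) (m : ℕ) (y z : ℝ) :
    bernoulliConv ε m 0 y z = normBernoulli m z := by
  simp [bernoulliConv, normBernoulli_zero]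

/-- Pascal's rule for `multichoose` splits the differentiated sum into the two convolutions of lower
index. -/
theorem hasDerivAt_bernoulliConv_right (ε : ℝ) (m n : ℕ) (y z : ℝ) :
    HasDerivAt (fun z => bernoulliConv ε (m + 1) (n + 1) y z)
      (bernoulliConv ε m (n + 1) y z + bernoulliConv ε (m + 1) n y z) z := by
  have h : HasDerivAt (fun z => bernoulliConv ε (m + 1) (n + 1) y z)
      (∑ p ∈ antidiagonal (n + 1), ε ^ p.2 * ((m + 1).multichoose p.1 : ℝ) * normBernoulli p.2 y *
        normBernoulli (m + p.1) z) z := by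
    unfold bernoulliConv
    refine HasDerivAt.fun_sum fun p _ => ?_
    rw [show m + 1 + p.1 = (m + p.1) + 1 by ring]
    exact (hasDerivAt_normBernoulli_succ _ _).const_mul _
  refine h.congr_deriv ?_
  unfold bernoulliConv
  rw [Finset.Nat.sum_antidiagonal_succ, Finset.Nat.sum_antidiagonal_succ, add_assoc,
    ← sum_add_distrib]
  congr 1
  · simp
  · refine sum_congr rfl fun p _ => ?_
    rw [Nat.multichoose_succ_succ, show m + 1 + p.1 = m + (p.1 + 1) by ring]
    push_cast
    ring

theorem hasDerivAt_bernoulliConv_left (ε : ℝ) (m n : ℕ) (y z : ℝ) :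
    HasDerivAt (fun y => bernoulliConv ε m (n + 1) y z) (ε * bernoulliConv ε m n y z) y := by
  simp only [bernoulliConv, mul_sum]
  simp_rw [Finset.Nat.sum_antidiagonal_succ' (n := n)]
  simp only [normBernoulli_zero]
  refine (HasDerivAt.add (f' := 0) (hasDerivAt_const y _) (HasDerivAt.fun_sum (u := antidiagonal n)
    (A' := fun p => ε ^ (p.2 + 1) * (m.multichoose p.1 : ℝ) * normBernoulli p.2 y *
        normBernoulli (m + p.1) z) fun p _ => ?_)).congr_deriv ?_
  · exact ((hasDerivAt_normBernoulli_succ _ _).const_mul _).mul_const _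
  · rw [zero_add]
    refine sum_congr rfl fun p _ => ?_
    ring

/-- With sign -1, the contribution of the `y` slot cancels the second of the two convolutions coming
from the `z` slot. -/
theorem hasDerivAt_bernoulliConv_diag (m n : ℕ) (x y : ℝ) :
    HasDerivAt (fun y => bernoulliConv (-1) (m + 1) n y (x + y))
      (bernoulliConv (-1) m n y (x + y)) y := by
  cases n with
  | zero =>
    simp only [bernoulliConv_zero_right]
    have := (hasDerivAt_normBernoulli_succ m (x + y)).comp_const_add x y
    exact this
  | succ n =>
    have h : HasDerivAt (fun y => bernoulliConv (-1) (m + 1) (n + 1) y (x + y))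
      (∑ p ∈ antidiagonal (n + 1), (((-1 : ℝ) ^ p.2 * ((m + 1).multichoose p.1 : ℝ)) *
        (if p.2 = 0 then 0 else normBernoulli (p.2 - 1) y) *  normBernoulli (m + 1 + p.1) (x + y)
        + ((-1 : ℝ) ^ p.2 * ((m + 1).multichoose p.1 : ℝ)) * normBernoulli p.2 y *
          normBernoulli (m + p.1) (x + y))) y := by
      unfold bernoulliConv
      refine HasDerivAt.fun_sum fun p _ => ?_
      refine HasDerivAt.mul (HasDerivAt.const_mul _ ?_) ?_
      · split_ifs with h0
        · rw [h0]
          simpa only [funext normBernoulli_zero] using hasDerivAt_const y (1 : ℝ)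
        · obtain ⟨k, hk⟩ := Nat.exists_eq_succ_of_ne_zero h0
          rw [hk]
          exact hasDerivAt_normBernoulli_succ _ _
      · rw [show m + 1 + p.1 = (m + p.1) + 1 by ring]
        exact (hasDerivAt_normBernoulli_succ _ (x + y)).comp_const_add x y
    refine h.congr_deriv ?_
    -- Uniqueness of derivatives identifies the two halves of the raw sum with the partial
    -- derivatives already computed.
    have h1 := (hasDerivAt_bernoulliConv_left (-1) (m + 1) n y (x + y)).unique (f := fun y' =>
      bernoulliConv (-1) (m + 1) (n + 1) y' (x + y)) (f₁' := ∑ p ∈ antidiagonal (n + 1),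
        (((-1 : ℝ) ^ p.2 * ((m + 1).multichoose p.1 : ℝ)) *
        (if p.2 = 0 then 0 else normBernoulli (p.2 - 1) y) *
          normBernoulli (m + 1 + p.1) (x + y))) (by
      unfold bernoulliConv
      refine HasDerivAt.fun_sum fun p _ => HasDerivAt.mul_const (HasDerivAt.const_mul _ ?_) _
      split_ifs with h0
      · rw [h0]
        simpa only [funext normBernoulli_zero] using hasDerivAt_const y (1 : ℝ)
      · obtain ⟨k, hk⟩ := Nat.exists_eq_succ_of_ne_zero h0
        rw [hk]
        exact hasDerivAt_normBernoulli_succ _ _)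
    have h2 := (hasDerivAt_bernoulliConv_right (-1) m n y (x + y)).unique (f := fun z =>
      bernoulliConv (-1) (m + 1) (n + 1) y z) (f₁' := ∑ p ∈ antidiagonal (n + 1),
        (((-1 : ℝ) ^ p.2 * ((m + 1).multichoose p.1 : ℝ)) * normBernoulli p.2 y *
          normBernoulli (m + p.1) (x + y))) (by
      unfold bernoulliConv
      refine HasDerivAt.fun_sum fun p _ => HasDerivAt.const_mul _ ?_
      rw [show m + 1 + p.1 = (m + p.1) + 1 by ring]
      exact hasDerivAt_normBernoulli_succ _ _)
    rw [sum_add_distrib]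
    linarith

theorem normBernoulli_add_two_eval_one (k : ℕ) :
    normBernoulli (k + 2) 1 = normBernoulli (k + 2) 0 := by
  simp [normBernoulli_eval_one]

/-- Among all B_k only B_1 takes different values at 0 and 1, so a single term survives. -/
theorem bernoulliConv_eval_one_sub_eval_zero (ε : ℝ) (m n : ℕ) (z : ℝ) :
    bernoulliConv ε m (n + 1) 1 z - bernoulliConv ε m (n + 1) 0 z =
      ε * (m.multichoose n : ℝ) * normBernoulli (m + n) z := by
  unfold bernoulliConv
  rw [← sum_sub_distrib, Finset.sum_eq_single (n, 1)]
  · simp [normBernoulli_eval_one]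
    ring
  · rintro ⟨i, j⟩ hij hne
    have : j ≠ 1 := by
      rintro rfl
      simp at hij hne
      exact hne hij
    simp [normBernoulli_eval_one, this]
  · simp

theorem bernoulliConv_add_two_eval_one (ε : ℝ) (m n : ℕ) (y : ℝ) :
    bernoulliConv ε (m + 2) n y 1 = bernoulliConv ε (m + 2) n y 0 := by
  unfold bernoulliConv
  refine sum_congr rfl fun p _ => ?_
  rw [show m + 2 + p.1 = (m + p.1) + 2 by ring, normBernoulli_add_two_eval_one]

/-- The defect in the product formula for Bernoulli polynomials; it vanishes identically. -/
noncomputable def bernoulliDefect (m n : ℕ) (x y : ℝ) : ℝ :=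
  normBernoulli m (x + y) * normBernoulli n x - (bernoulliConv (-1) m n y (x + y) +
    bernoulliConv 1 n m y x - (-1) ^ n * normBernoulli (m + n) y)

theorem hasDerivAt_bernoulliDefect_right (m n : ℕ) (x y : ℝ) :
    HasDerivAt (fun y => bernoulliDefect (m + 1) n x y) (bernoulliDefect m n x y) y := by
  have h1 := ((hasDerivAt_normBernoulli_succ m (x + y)).comp_const_add x y).mul_const
    (normBernoulli n x)
  have h2 := hasDerivAt_bernoulliConv_diag m n x y
  have h3 := hasDerivAt_bernoulliConv_left 1 n m y x
  have h4 := (hasDerivAt_normBernoulli_succ (m + n) y).const_mul ((-1 : ℝ) ^ n)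
  rw [show m + n + 1 = m + 1 + n by ring] at h4
  refine (h1.sub ((h2.add h3).sub h4)).congr_deriv ?_
  rw [bernoulliDefect, one_mul]

theorem hasDerivAt_bernoulliDefect_left (m n : ℕ) (x y : ℝ) :
    HasDerivAt (fun x => bernoulliDefect (m + 1) (n + 1) x y)
      (bernoulliDefect m (n + 1) x y + bernoulliDefect (m + 1) n x y) x := by
  have h1 := ((hasDerivAt_normBernoulli_succ m (x + y)).comp_add_const x y).mul
    (hasDerivAt_normBernoulli_succ n x)
  have h2 := (hasDerivAt_bernoulliConv_right (-1) m n y (x + y)).comp_add_const x y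
  have h3 := hasDerivAt_bernoulliConv_right 1 n m y x
  have h4 := (hasDerivAt_const x ((-1 : ℝ) ^ (n + 1) * normBernoulli (m + 1 + (n + 1)) y))
  refine (h1.sub ((h2.add h3).sub h4)).congr_deriv ?_
  rw [bernoulliDefect, bernoulliDefect, show m + (n + 1) = m + 1 + n by ring]
  ring

/-- The two convolutions jump by opposite amounts, by the symmetry of binomial coefficients; no
other term jumps, its index being at least 2. -/
theorem bernoulliDefect_add_two_eval_one (m n : ℕ) :
    bernoulliDefect (m + 2) (n + 1) 0 1 = bernoulliDefect (m + 2) (n + 1) 0 0 := by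
  have h1 := bernoulliConv_eval_one_sub_eval_zero (-1) (m + 2) n 0
  have h2 := bernoulliConv_eval_one_sub_eval_zero 1 (n + 1) (m + 1) 0
  have h3 : (m + 2).multichoose n = (n + 1).multichoose (m + 1) := by
    rw [Nat.multichoose_eq, Nat.multichoose_eq, show m + 2 + n - 1 = m + 1 + n by omega,
      show n + 1 + (m + 1) - 1 = m + 1 + n by omega, Nat.choose_symm_add]
  have h4 : normBernoulli (m + 2 + (n + 1)) 1 = normBernoulli (m + 2 + (n + 1)) 0 := by
    rw [show m + 2 + (n + 1) = m + n + 1 + 2 by ring, normBernoulli_add_two_eval_one]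
  rw [bernoulliDefect, bernoulliDefect, zero_add, zero_add, bernoulliConv_add_two_eval_one,
    normBernoulli_add_two_eval_one, h4]
  rw [h3, show m + 2 + n = n + 1 + (m + 1) by ring] at h1
  rw [show m + 2 = m + 1 + 1 by ring] at *
  linarith

/-- Induction on m + n: both partial derivatives are combinations of lower defects, so the defect is
a constant, which the values at y = 0 and y = 1 one level higher show to be zero. -/
theorem bernoulliDefect_eq_zero (m n : ℕ) (x y : ℝ) : bernoulliDefect m n x y = 0 := by
  induction hN : m + n using Nat.strong_induction_on generalizing m n x y with
  | _ N ih =>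
  rcases m with _ | m
  · simp [bernoulliDefect, bernoulliConv_zero_left, bernoulliConv_zero_right, normBernoulli_zero]
  rcases n with _ | n
  · simp [bernoulliDefect, bernoulliConv_zero_left, bernoulliConv_zero_right, normBernoulli_zero]
  have hx : ∀ x y, bernoulliDefect (m + 1) (n + 1) x y = bernoulliDefect (m + 1) (n + 1) 0 y := by
    intro x y
    have hd : ∀ x, HasDerivAt (fun x => bernoulliDefect (m + 1) (n + 1) x y) 0 x := fun x =>
      (hasDerivAt_bernoulliDefect_left m n x y).congr_deriv (by
        rw [ih (m + (n + 1)) (by omega) _ _ _ _ rfl, ih (m + 1 + n) (by omega) _ _ _ _ rfl,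
          add_zero])
    exact is_const_of_deriv_eq_zero (fun x => (hd x).differentiableAt) (fun x => (hd x).deriv) x 0
  have hy : ∀ x y, bernoulliDefect (m + 1) (n + 1) x y = bernoulliDefect (m + 1) (n + 1) x 0 := by
    intro x y
    have hd : ∀ y, HasDerivAt (fun y => bernoulliDefect (m + 1) (n + 1) x y) 0 y := fun y =>
      (hasDerivAt_bernoulliDefect_right m (n + 1) x y).congr_deriv
        (ih (m + (n + 1)) (by omega) _ _ _ _ rfl)
    exact is_const_of_deriv_eq_zero (fun x => (hd x).differentiableAt) (fun x => (hd x).deriv) y 0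
  rw [hy, hx]
  set c := bernoulliDefect (m + 1) (n + 1) 0 0 with hc
  -- The defect with first index raised by one is affine in y with slope c; equal values at 0 and 1
  -- force c = 0.
  have hd : ∀ y, HasDerivAt (fun y => bernoulliDefect (m + 2) (n + 1) 0 y - c * y) 0 y := fun y =>
    ((hasDerivAt_bernoulliDefect_right (m + 1) (n + 1) 0 y).sub
      ((hasDerivAt_id y).const_mul c)).congr_deriv (by rw [hy]; simp [hc])
  have h := is_const_of_deriv_eq_zero (fun x => (hd x).differentiableAt) (fun x => (hd x).deriv) 1 0
  rw [bernoulliDefect_add_two_eval_one] at h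
  linarith

/-- The product formula for Bernoulli polynomials (in the divided normalization `B_k / k!`). -/
theorem normBernoulli_mul (m n : ℕ) (x y : ℝ) :
    normBernoulli m (x + y) * normBernoulli n x = bernoulliConv (-1) m n y (x + y) +
      bernoulliConv 1 n m y x - (-1) ^ n * normBernoulli (m + n) y :=
  sub_eq_zero.mp (bernoulliDefect_eq_zero m n x y)

end

/-! ### From Bernoulli polynomials to Bernoulli functions. -/

section

open Finset

/-- `∑_{i + j = n} ε ^ j * multichoose m i * b_j * c_{m+i}`. -/
noncomputable def multichooseConv (ε : ℝ) (m n : ℕ) (b c : ℕ → ℝ) : ℝ :=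
  ∑ p ∈ antidiagonal n, ε ^ p.2 * (m.multichoose p.1 : ℝ) * b p.2 * c (m + p.1)

/-- The shape of the product formula for Bernoulli polynomials, as a relation between the
sequences of values at three points. -/
def ProductFormula (m n : ℕ) (a b c : ℕ → ℝ) : Prop :=
  c m * a n = multichooseConv (-1) m n b c + multichooseConv 1 n m b a - (-1) ^ n * b (m + n)

theorem productFormula_normBernoulli (m n : ℕ) (x y : ℝ) :
    ProductFormula m n (normBernoulli · x) (normBernoulli · y) (normBernoulli · (x + y)) :=
  normBernoulli_mul m n x y

theorem multichooseConv_neg_one_pow_mul (ε : ℝ) (m n : ℕ) (b c : ℕ → ℝ) :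
    multichooseConv ε m n (fun k => (-1) ^ k * b k) (fun k => (-1) ^ k * c k) =
      (-1) ^ (m + n) * multichooseConv ε m n b c := by
  unfold multichooseConv
  rw [mul_sum]
  refine sum_congr rfl fun p hp => ?_
  rw [← mem_antidiagonal.mp hp]
  ring

/-- The formula is homogeneous: the indices in every term add up to m + n. -/
theorem ProductFormula.neg_one_pow_mul {m n : ℕ} {a b c : ℕ → ℝ} (h : ProductFormula m n a b c) :
    ProductFormula m n (fun k => (-1) ^ k * a k) (fun k => (-1) ^ k * b k)
      (fun k => (-1) ^ k * c k) := by
  unfold ProductFormula at *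
  rw [multichooseConv_neg_one_pow_mul, multichooseConv_neg_one_pow_mul]
  have : (-1 : ℝ) ^ m * c m * ((-1) ^ n * a n) = (-1) ^ (m + n) * (c m * a n) := by ring
  rw [this, h]
  ring

/-- At most one of two indices with sum at least 3 attains its mean from differing values: if one
index is 1, the other is not, so one factor is common to both products. -/
theorem avg_mul_avg {N j k : ℕ} (hN : 3 ≤ N) (hjk : j + k = N) {b b' c c' : ℕ → ℝ}
    (hb : ∀ k ≠ 1, b k = b' k) (hc : ∀ k ≠ 1, c k = c' k) :
    (b j + b' j) / 2 * ((c k + c' k) / 2) = (b j * c k + b' j * c' k) / 2 := by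
  by_cases hj : j = 1
  · rw [hc k (by omega)]; ring
  · rw [hb j hj]; ring

theorem ProductFormula.avg {m n : ℕ} (hmn : 3 ≤ m + n) {a a' b b' c c' : ℕ → ℝ}
    (h : ProductFormula m n a b c) (h' : ProductFormula m n a' b' c')
    (ha : ∀ k ≠ 1, a k = a' k) (hb : ∀ k ≠ 1, b k = b' k) (hc : ∀ k ≠ 1, c k = c' k) :
    ProductFormula m n (fun k => (a k + a' k) / 2) (fun k => (b k + b' k) / 2)
      (fun k => (c k + c' k) / 2) := by
  have key : ∀ (ε : ℝ) (m n : ℕ) (c c' : ℕ → ℝ), 3 ≤ m + n → (∀ k ≠ 1, c k = c' k) →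
      multichooseConv ε m n (fun k => (b k + b' k) / 2) (fun k => (c k + c' k) / 2) =
        (multichooseConv ε m n b c + multichooseConv ε m n b' c') / 2 := by
    intro ε m n c c' hmn hc
    unfold multichooseConv
    rw [← sum_add_distrib, sum_div]
    refine sum_congr rfl fun p hp => ?_
    have := mem_antidiagonal.mp hp
    rw [mul_assoc (_ * _), avg_mul_avg hmn (by omega) hb hc]
    ring
  unfold ProductFormula at *
  rw [key _ _ _ _ _ hmn hc, key _ _ _ _ _ (by omega) ha, avg_mul_avg hmn rfl hc ha, h, h']
  ring

theorem productFormula_fract (m n : ℕ) (x y : ℝ) :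
    ProductFormula m n (normBernoulli · (Int.fract x)) (normBernoulli · (Int.fract y))
      (normBernoulli · (Int.fract (x + y))) := by
  have hx := Int.floor_add_fract x
  have hy := Int.floor_add_fract y
  have hx0 := Int.fract_nonneg x
  have hy0 := Int.fract_nonneg y
  have hx1 := Int.fract_lt_one x
  have hy1 := Int.fract_lt_one y
  rcases lt_or_ge (Int.fract x + Int.fract y) 1 with h | h
  · have : Int.fract (x + y) = Int.fract x + Int.fract y := by
      rw [Int.fract_eq_iff]
      exact ⟨by positivity, h, ⌊x⌋ + ⌊y⌋, by push_cast; linarith⟩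
    rw [this]
    exact productFormula_normBernoulli m n _ _
  · have : Int.fract (x + y) = Int.fract x + Int.fract y - 1 := by
      rw [Int.fract_eq_iff]
      exact ⟨by linarith, by linarith, ⌊x⌋ + ⌊y⌋ + 1, by push_cast; linarith⟩
    -- When the fractional parts carry, the reflection B_k(1-x) = (-1)^k B_k(x) moves the identity
    -- to complementary points, whose sum is again 1 minus a fractional part.
    have h2 := (productFormula_normBernoulli m n (1 - Int.fract x) (1 - Int.fract y)).neg_one_pow_mul
    rw [show 1 - Int.fract x + (1 - Int.fract y) = 1 - Int.fract (x + y) by rw [this]; ring] at h2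
    simp only [normBernoulli_one_sub, ← mul_assoc, ← mul_pow, mul_neg, mul_one, neg_neg, one_pow,
      one_mul] at h2
    exact h2

/-- The Bernoulli function `B̄_k` divided by `k!`. -/
noncomputable def normBernoulliBar (k : ℕ) (x : ℝ) : ℝ := bernoulliBar k x / k.factorial

theorem bernoulliBar_eq_factorial_mul (k : ℕ) (x : ℝ) :
    bernoulliBar k x = k.factorial * normBernoulliBar k x := by
  rw [normBernoulliBar, mul_div_cancel₀]
  positivity

theorem normBernoulli_fract_eq_of_ne_one (x : ℝ) (k : ℕ) (hk : k ≠ 1) :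
    normBernoulli k (Int.fract x) = (-1) ^ k * normBernoulli k (Int.fract (-x)) := by
  by_cases h : Int.fract x = 0
  · rw [h, Int.fract_neg_eq_zero.mpr h, ← normBernoulli_one_sub, sub_zero, normBernoulli_eval_one,
      if_neg hk, add_zero]
  · rw [Int.fract_neg h, ← normBernoulli_one_sub, sub_sub_cancel]

/-- B̄_k is the mean of its right and left limits; the convention B̄_1 = 0 at integers is exactly
this mean. -/
theorem normBernoulliBar_eq_avg (k : ℕ) (x : ℝ) : normBernoulliBar k x =
    (normBernoulli k (Int.fract x) + (-1) ^ k * normBernoulli k (Int.fract (-x))) / 2 := by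
  by_cases hk : k = 1 ∧ Int.fract x = 0
  · obtain ⟨rfl, hx⟩ := hk
    simp [normBernoulliBar, bernoulliBar, hx, Int.fract_neg_eq_zero.mpr hx]
  · have h : normBernoulli k (Int.fract x) = (-1) ^ k * normBernoulli k (Int.fract (-x)) := by
      by_cases hk1 : k = 1
      · have hx : Int.fract x ≠ 0 := fun hx => hk ⟨hk1, hx⟩
        rw [Int.fract_neg hx, ← normBernoulli_one_sub, sub_sub_cancel]
      · exact normBernoulli_fract_eq_of_ne_one x k hk1
    rw [← h, normBernoulliBar, bernoulliBar, if_neg hk, normBernoulli]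
    ring

theorem normBernoulliBar_neg (k : ℕ) (x : ℝ) :
    normBernoulliBar k (-x) = (-1) ^ k * normBernoulliBar k x := by
  rw [normBernoulliBar_eq_avg, normBernoulliBar_eq_avg, neg_neg]
  rcases neg_one_pow_eq_or ℝ k with h | h <;> rw [h] <;> ring

theorem normBernoulliBar_add_intCast (k : ℕ) (x : ℝ) (N : ℤ) :
    normBernoulliBar k (x + N) = normBernoulliBar k x := by
  simp only [normBernoulliBar, bernoulliBar, Int.fract_add_intCast]

/-- The mean of the formula at (x, y) and its reflection from (-x, -y). Averaging respects the
products because m + n ≥ 3. -/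
theorem productFormula_normBernoulliBar {m n : ℕ} (hmn : 3 ≤ m + n) (x y : ℝ) :
    ProductFormula m n (normBernoulliBar · x) (normBernoulliBar · y)
      (normBernoulliBar · (x + y)) := by
  simp only [normBernoulliBar_eq_avg]
  have h := (productFormula_fract m n (-x) (-y)).neg_one_pow_mul
  rw [← neg_add] at h
  exact (productFormula_fract m n x y).avg hmn h (normBernoulli_fract_eq_of_ne_one x)
    (normBernoulli_fract_eq_of_ne_one y) (normBernoulli_fract_eq_of_ne_one (x + y))

theorem normBernoulliBar_zero_left (x : ℝ) : normBernoulliBar 0 x = 1 := by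
  simp [normBernoulliBar, bernoulliBar]

theorem normBernoulliBar_one (x : ℝ) :
    normBernoulliBar 1 x = if Int.fract x = 0 then 0 else Int.fract x - 1 / 2 := by
  simp [normBernoulliBar, bernoulliBar]

theorem normBernoulliBar_two (x : ℝ) :
    normBernoulliBar 2 x = (Int.fract x ^ 2 - Int.fract x + 6⁻¹) / 2 := by
  simp [normBernoulliBar, bernoulliBar]

open Classical in
-- In weight 2 both factors may jump at once, so averaging fails. At integers the left side is 0
-- while the uncorrected right side is 3 · B_2/2! = 1/4.
theorem normBernoulliBar_one_mul_one (x y : ℝ) :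
    normBernoulliBar 1 (x + y) * normBernoulliBar 1 x =
      multichooseConv (-1) 1 1 (normBernoulliBar · y) (normBernoulliBar · (x + y)) +
      multichooseConv 1 1 1 (normBernoulliBar · y) (normBernoulliBar · x)
      - (-1) ^ 1 * normBernoulliBar (1 + 1) y
      - if Int.fract x = 0 ∧ Int.fract y = 0 then 1 / 4 else 0 := by
  simp only [multichooseConv, Finset.Nat.antidiagonal_succ, Finset.Nat.antidiagonal_zero]
  simp only [map_singleton, sum_cons, sum_singleton, Function.Embedding.prodMap,
    Function.Embedding.coeFn_mk, Prod.map, Nat.multichoose_one_right, Nat.multichoose_zero_right]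
  simp only [pow_one, pow_zero, Nat.cast_one, one_mul, add_zero, Nat.succ_eq_add_one, zero_add,
    Function.Embedding.refl_apply, one_add_one_eq_two, normBernoulliBar_zero_left,
    normBernoulliBar_two, normBernoulliBar_one]
  have hx := Int.floor_add_fract x
  have hy := Int.floor_add_fract y
  have hx0 := Int.fract_nonneg x
  have hy0 := Int.fract_nonneg y
  have hx1 := Int.fract_lt_one x
  have hy1 := Int.fract_lt_one y
  rcases lt_or_ge (Int.fract x + Int.fract y) 1 with h | h
  · have h2 : Int.fract (x + y) = Int.fract x + Int.fract y := by
      rw [Int.fract_eq_iff]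
      exact ⟨by positivity, h, ⌊x⌋ + ⌊y⌋, by push_cast; linarith⟩
    rw [h2]
    generalize Int.fract x = u at *
    generalize Int.fract y = v at *
    by_cases hu : u = 0
    · by_cases hv : v = 0
      · simp [hu, hv]; norm_num
      · simp [hu, hv]; ring
    · by_cases hv : v = 0
      · simp [hu, hv]; ring
      · have : u + v ≠ 0 := by
          have := lt_of_le_of_ne hx0 (Ne.symm hu)
          linarith
        simp [hu, hv, this]; ring
  · have h2 : Int.fract (x + y) = Int.fract x + Int.fract y - 1 := by
      rw [Int.fract_eq_iff]
      exact ⟨by linarith, by linarith, ⌊x⌋ + ⌊y⌋ + 1, by push_cast; linarith⟩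
    rw [h2]
    generalize Int.fract x = u at *
    generalize Int.fract y = v at *
    have hu : u ≠ 0 := by linarith
    have hv : v ≠ 0 := by linarith
    by_cases hz : u + v - 1 = 0
    · have : v = 1 - u := by linarith
      subst this
      simp [hu, hv]; ring
    · simp [hu, hv, hz]; ring

end

/-! ### Sums over residues, the multiplication theorem, Dedekind reciprocity. -/

section

open Finset

theorem apply_val_intCast_of_periodic {M : Type*} {e : ℕ} [NeZero e] {h : ℤ → M}
    (hp : Function.Periodic h (e : ℤ)) (t : ℤ) : h (((t : ZMod e).val : ℕ) : ℤ) = h t := by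
  rw [ZMod.val_intCast, Int.emod_def, mul_comm]
  exact hp.sub_int_mul_eq _

theorem sum_range_natCast_zmod {M : Type*} [AddCommMonoid M] (e : ℕ) [NeZero e] (f : ZMod e → M) :
    ∑ t ∈ range e, f (t : ZMod e) = ∑ z, f z := by
  refine sum_nbij' (fun t => (t : ZMod e)) (fun z => z.val) ?_ ?_ ?_ ?_ ?_
  · simp
  · intro z _
    simpa using ZMod.val_lt z
  · intro t ht
    exact ZMod.val_cast_of_lt (by simpa using ht)
  · intro z _
    exact ZMod.natCast_zmod_val z
  · simp

theorem sum_range_eq_sum_zmod {M : Type*} [AddCommMonoid M] {e : ℕ} [NeZero e] {h : ℤ → M}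
    (hp : Function.Periodic h (e : ℤ)) : ∑ t ∈ range e, h t = ∑ z : ZMod e, h (z.val : ℤ) := by
  rw [← sum_range_natCast_zmod]
  refine sum_congr rfl fun t _ => ?_
  have := apply_val_intCast_of_periodic hp t
  push_cast at this
  exact this.symm

theorem sum_range_comp_add_of_periodic {M : Type*} [AddCommMonoid M] {e : ℕ} [NeZero e] {h : ℤ → M}
    (hp : Function.Periodic h (e : ℤ)) (N : ℤ) : ∑ t ∈ range e, h (N + t) = ∑ t ∈ range e, h t := by
  rw [sum_range_eq_sum_zmod hp, ← Equiv.sum_comp (Equiv.addLeft (N : ZMod e)),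
    ← sum_range_natCast_zmod]
  refine sum_congr rfl fun t _ => ?_
  rw [← apply_val_intCast_of_periodic hp]
  simp

theorem sum_range_comp_neg_of_periodic {M : Type*} [AddCommMonoid M] {e : ℕ} [NeZero e] {h : ℤ → M}
    (hp : Function.Periodic h (e : ℤ)) : ∑ t ∈ range e, h (-t) = ∑ t ∈ range e, h t := by
  rw [sum_range_eq_sum_zmod hp, ← Equiv.sum_comp (Equiv.neg (ZMod e)), ← sum_range_natCast_zmod]
  refine sum_congr rfl fun t _ => ?_
  rw [← apply_val_intCast_of_periodic hp]
  simp

theorem sum_range_comp_mul_of_periodic {M : Type*} [AddCommMonoid M] {e : ℕ} [NeZero e] {h : ℤ → M}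
    (hp : Function.Periodic h (e : ℤ)) {u : ℕ} (hu : u.Coprime e) :
    ∑ t ∈ range e, h (u * t) = ∑ t ∈ range e, h t := by
  rw [sum_range_eq_sum_zmod hp, ← Equiv.sum_comp (Units.mulLeft (ZMod.unitOfCoprime u hu)),
    ← sum_range_natCast_zmod]
  refine sum_congr rfl fun t _ => ?_
  rw [← apply_val_intCast_of_periodic hp]
  simp

theorem sum_Icc_eq_sum_range_of_periodic {M : Type*} [AddCommMonoid M] {e : ℕ} [NeZero e]
    {h : ℤ → M} (hp : Function.Periodic h (e : ℤ)) :
    ∑ t ∈ Icc 1 e, h t = ∑ t ∈ range e, h t := by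
  rw [← sum_range_comp_add_of_periodic hp 1, Finset.range_eq_Ico,
    ← Finset.Ico_add_one_right_eq_Icc, Finset.sum_Ico_eq_sum_range, ← Finset.range_eq_Ico]
  simp

theorem periodic_comp_div {M : Type*} {f : ℝ → M} (hf : Function.Periodic f 1) (e : ℕ) [NeZero e]
    (x : ℝ) : Function.Periodic (fun t : ℤ => f (x + t / e)) (e : ℤ) := by
  intro t
  have : (e : ℝ) ≠ 0 := NeZero.ne _
  simp only
  rw [← hf (x + t / e)]
  congr 1
  push_cast
  field_simp
  ring

theorem sum_bernoulliFun_fract (k e : ℕ) [NeZero e] (x : ℝ) :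
    bernoulliFun k (Int.fract (e * x)) =
      e ^ k / e * ∑ i ∈ range e, bernoulliFun k (Int.fract (x + i / e)) := by
  have he : (0 : ℝ) < e := by exact_mod_cast NeZero.pos e
  have hp := periodic_comp_div (f := fun x => bernoulliFun k (Int.fract x))
    (fun x => by simp only [Int.fract_add_one]) e (Int.fract (e * x) / e)
  -- Shifting the index by ⌊ex⌋ moves the base point to {ex}/e in [0, 1/e). All e sample points then
  -- lie in [0, 1), where the polynomial theorem applies.
  have h1 := sum_range_comp_add_of_periodic hp ⌊(e : ℝ) * x⌋
  have h2 : ∀ i : ℕ, Int.fract (e * x) / e + ((⌊(e : ℝ) * x⌋ + (i : ℤ) : ℤ) : ℝ) / e = x + i / e := by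
    intro i
    have := Int.floor_add_fract ((e : ℝ) * x)
    push_cast
    rw [← add_div, ← add_assoc, add_comm (Int.fract _), this]
    field_simp
  simp only [h2] at h1
  rw [h1]
  have h3 := bernoulliFun_mul k (NeZero.ne e) (Int.fract (e * x) / e)
  rw [mul_div_cancel₀ _ he.ne'] at h3
  rw [h3]
  congr 1
  refine sum_congr rfl fun i hi => ?_
  congr 1
  rw [eq_comm, Int.cast_natCast, Int.fract_eq_self, ← add_div]
  have hi' : (i : ℝ) + 1 ≤ e := by exact_mod_cast mem_range.mp hi
  refine ⟨div_nonneg (add_nonneg (Int.fract_nonneg _) (Nat.cast_nonneg _)) he.le, ?_⟩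
  rw [div_lt_one he]
  linarith [Int.fract_lt_one ((e : ℝ) * x)]

/-- The multiplication theorem for Bernoulli functions. -/
theorem normBernoulliBar_mul (k e : ℕ) [NeZero e] (x : ℝ) :
    normBernoulliBar k (e * x) = e ^ k / e * ∑ i ∈ range e, normBernoulliBar k (x + i / e) := by
  have h1 := sum_bernoulliFun_fract k e x
  have h2 := sum_bernoulliFun_fract k e (-x)
  have hp := periodic_comp_div (f := fun x => bernoulliFun k (Int.fract x))
    (fun x => by simp only [Int.fract_add_one]) e (-x)
  -- The left limits require the theorem at -x, with the sum reversed by i ↦ -i.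
  have h3 := sum_range_comp_neg_of_periodic hp
  simp only [Int.cast_neg, Int.cast_natCast] at h3
  rw [← h3] at h2
  simp only [normBernoulliBar_eq_avg, ← sum_div, sum_add_distrib, ← mul_sum, normBernoulli]
  rw [h1, ← mul_neg, h2]
  simp only [neg_div, neg_add]
  ring

theorem sum_normBernoulliBar_add_div (k e : ℕ) [NeZero e] (x : ℝ) :
    ∑ i ∈ range e, normBernoulliBar k (x + i / e) = e / e ^ k * normBernoulliBar k (e * x) := by
  have he : (e : ℝ) ≠ 0 := NeZero.ne _
  rw [normBernoulliBar_mul]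
  field_simp

theorem sum_normBernoulliBar_div (k e : ℕ) [NeZero e] :
    ∑ i ∈ range e, normBernoulliBar k (i / e) = e / e ^ k * normBernoulliBar k 0 := by
  simpa using sum_normBernoulliBar_add_div k e 0

theorem normBernoulliBar_mul_normBernoulliBar {m n : ℕ} (hm : 1 ≤ m) (hn : 1 ≤ n) (x y : ℝ) :
    normBernoulliBar m (x + y) * normBernoulliBar n x =
      multichooseConv (-1) m n (normBernoulliBar · y) (normBernoulliBar · (x + y)) +
      multichooseConv 1 n m (normBernoulliBar · y) (normBernoulliBar · x)
      - (-1) ^ n * normBernoulliBar (m + n) y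
      - (if m = 1 ∧ n = 1 then 1 / 4 else 0) *
        ((if Int.fract x = 0 then 1 else 0) * if Int.fract y = 0 then 1 else 0) := by
  by_cases h : m = 1 ∧ n = 1
  · obtain ⟨rfl, rfl⟩ := h
    rw [normBernoulliBar_one_mul_one]
    congr 1
    by_cases h1 : Int.fract x = 0 <;> by_cases h2 : Int.fract y = 0 <;> simp [h1, h2]
  · rw [if_neg h, zero_mul, sub_zero]
    exact productFormula_normBernoulliBar (by omega) x y

theorem sum_fract_div_eq_zero (e : ℕ) [NeZero e] :
    ∑ i ∈ range e, (if Int.fract ((i : ℝ) / e) = 0 then (1 : ℝ) else 0) = 1 := by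
  have he : (0 : ℝ) < e := by exact_mod_cast NeZero.pos e
  rw [Finset.sum_eq_single 0]
  · simp
  · intro i hi h0
    have hi' : (i : ℝ) < e := by exact_mod_cast mem_range.mp hi
    rw [if_neg]
    rw [Int.fract_eq_self.mpr ⟨by positivity, (div_lt_one he).mpr hi'⟩]
    have : (i : ℝ) ≠ 0 := by exact_mod_cast h0
    positivity
  · intro h
    exact absurd (mem_range.mpr (NeZero.pos e)) h

/-- The generalized Dedekind sum `∑_{c mod d} B̄_m(ac/d) B̄_n(c/d) / (m! n!)`. -/
noncomputable def dedekindSum (m n a d : ℕ) : ℝ :=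
  ∑ c ∈ range d, normBernoulliBar m (a * (c / d)) * normBernoulliBar n (c / d)

/-- The reciprocity law for generalized Dedekind sums. -/
theorem dedekindSum_reciprocity {m n : ℕ} (hm : 1 ≤ m) (hn : 1 ≤ n) (a d : ℕ) [NeZero a]
    [NeZero d] :
    (d : ℝ) ^ (m + n) / d * dedekindSum m n a d =
      a ^ m / a * ∑ p ∈ antidiagonal n, (-1) ^ p.2 * (m.multichoose p.1 : ℝ) * (d ^ p.2 *
        ∑ l ∈ range a, normBernoulliBar p.2 (l / a) * normBernoulliBar (m + p.1) (d * (l / a)))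
      + ∑ p ∈ antidiagonal m, (n.multichoose p.1 : ℝ) * a ^ p.1 * d ^ p.2 *
          normBernoulliBar p.2 0 * normBernoulliBar (n + p.1) 0
      - (-1) ^ n * d ^ (m + n) / a ^ n * normBernoulliBar (m + n) 0
      - if m = 1 ∧ n = 1 then (d : ℝ) / 4 else 0 := by
  have ha : (a : ℝ) ≠ 0 := NeZero.ne _
  have hd : (d : ℝ) ≠ 0 := NeZero.ne _
  -- The multiplication theorem spreads B̄_m(a · c/d) over the points c/d + l/a, so that the product
  -- formula applies with x = c/d and y = l/a.
  have h1 : dedekindSum m n a d = a ^ m / a * ∑ c ∈ range d, ∑ l ∈ range a,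
      normBernoulliBar m (c / d + l / a) * normBernoulliBar n (c / d) := by
    unfold dedekindSum
    rw [mul_sum]
    refine sum_congr rfl fun c _ => ?_
    rw [normBernoulliBar_mul, ← sum_mul, mul_assoc]
  -- Here only the factor at c/d + l/a involves c, and the multiplication theorem sums it over c.
  have h2 : ∑ c ∈ range d, ∑ l ∈ range a, multichooseConv (-1) m n
      (normBernoulliBar · ((l : ℝ) / a)) (normBernoulliBar · ((c : ℝ) / d + l / a)) =
      ∑ p ∈ antidiagonal n, (-1) ^ p.2 * (m.multichoose p.1 : ℝ) * (d / d ^ (m + p.1) *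
        ∑ l ∈ range a, normBernoulliBar p.2 (l / a) *
          normBernoulliBar (m + p.1) (d * (l / a))) := by
    unfold multichooseConv
    rw [sum_comm]
    simp_rw [sum_comm (s := range d) (t := antidiagonal n)]
    rw [sum_comm]
    refine sum_congr rfl fun p _ => ?_
    rw [mul_sum, mul_sum]
    refine sum_congr rfl fun l _ => ?_
    rw [← mul_sum]
    simp_rw [add_comm (_ / (d : ℝ))]
    rw [sum_normBernoulliBar_add_div]
    ring
  -- Here the double sum separates, and each factor collapses to a value at 0.
  have h3 : ∑ c ∈ range d, ∑ l ∈ range a, multichooseConv 1 n m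
      (normBernoulliBar · ((l : ℝ) / a)) (normBernoulliBar · ((c : ℝ) / d)) =
      ∑ p ∈ antidiagonal m, (n.multichoose p.1 : ℝ) * (a / a ^ p.2 * normBernoulliBar p.2 0) *
        (d / d ^ (n + p.1) * normBernoulliBar (n + p.1) 0) := by
    unfold multichooseConv
    simp_rw [sum_comm (s := range a) (t := antidiagonal m)]
    rw [sum_comm]
    refine sum_congr rfl fun p _ => ?_
    rw [← sum_normBernoulliBar_div, ← sum_normBernoulliBar_div, mul_assoc, sum_mul_sum, sum_comm,
      mul_sum]
    refine sum_congr rfl fun l _ => ?_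
    rw [mul_sum]
    refine sum_congr rfl fun c _ => ?_
    ring
  have h4 : ∑ c ∈ range d, ∑ l ∈ range a, (-1) ^ n * normBernoulliBar (m + n) ((l : ℝ) / a) =
      d * ((-1) ^ n * (a / a ^ (m + n) * normBernoulliBar (m + n) 0)) := by
    rw [← sum_normBernoulliBar_div, mul_sum]
    simp
  have h5 : ∑ c ∈ range d, ∑ l ∈ range a, (if m = 1 ∧ n = 1 then (1 / 4 : ℝ) else 0) *
        ((if Int.fract ((c : ℝ) / d) = 0 then 1 else 0) *
          if Int.fract ((l : ℝ) / a) = 0 then 1 else 0) =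
      if m = 1 ∧ n = 1 then 1 / 4 else 0 := by
    simp_rw [← mul_sum]
    rw [← sum_mul, sum_fract_div_eq_zero, sum_fract_div_eq_zero]
    ring
  simp_rw [normBernoulliBar_mul_normBernoulliBar hm hn, sum_sub_distrib, sum_add_distrib] at h1
  rw [h2, h3, h4, h5] at h1
  rw [h1]
  have e1 : (d : ℝ) ^ (m + n) / d * (a ^ m / a * ∑ p ∈ antidiagonal n, (-1) ^ p.2 *
      (m.multichoose p.1 : ℝ) * (d / d ^ (m + p.1) * ∑ l ∈ range a, normBernoulliBar p.2 (l / a) *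
          normBernoulliBar (m + p.1) (d * (l / a)))) =
      a ^ m / a * ∑ p ∈ antidiagonal n, (-1) ^ p.2 * (m.multichoose p.1 : ℝ) * (d ^ p.2 *
        ∑ l ∈ range a, normBernoulliBar p.2 (l / a) *
          normBernoulliBar (m + p.1) (d * (l / a))) := by
    rw [mul_left_comm, mul_sum]
    congr 1
    refine sum_congr rfl fun p hp => ?_
    rw [← mem_antidiagonal.mp hp, ← add_assoc, pow_add]
    field_simp
  have e2 : (d : ℝ) ^ (m + n) / d * (a ^ m / a * ∑ p ∈ antidiagonal m, (n.multichoose p.1 : ℝ) *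
      (a / a ^ p.2 * normBernoulliBar p.2 0) *
        (d / d ^ (n + p.1) * normBernoulliBar (n + p.1) 0)) =
      ∑ p ∈ antidiagonal m, (n.multichoose p.1 : ℝ) * a ^ p.1 * d ^ p.2 *
          normBernoulliBar p.2 0 * normBernoulliBar (n + p.1) 0 := by
    rw [mul_sum, mul_sum]
    refine sum_congr rfl fun p hp => ?_
    rw [← mem_antidiagonal.mp hp, pow_add, pow_add, pow_add, pow_add]
    field_simp
  have e4 : (d : ℝ) ^ (m + n) / d * (a ^ m / a * (d * ((-1) ^ n * (a / a ^ (m + n) *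
      normBernoulliBar (m + n) 0)))) =
      (-1) ^ n * d ^ (m + n) / a ^ n * normBernoulliBar (m + n) 0 := by
    rw [pow_add (a : ℝ)]
    field_simp
  have e5 : (d : ℝ) ^ (m + n) / d * (a ^ m / a * (if m = 1 ∧ n = 1 then (1 / 4 : ℝ) else 0)) =
      if m = 1 ∧ n = 1 then (d : ℝ) / 4 else 0 := by
    split_ifs with h
    · rw [h.1, h.2]
      field_simp
    · simp
  rw [← e1, ← e2, ← e4, ← e5]
  ring

end

/-! ### Jordan totients and the Möbius-weighted reciprocity law. -/

section

open Finset

/-- Expanding the Euler product over sets of primes gives the squarefree divisors, the only ones on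
which μ is nonzero. -/
theorem jordanTotient_eq_sum {k q : ℕ} (hq : q ≠ 0) :
    jordanTotient k q =
      ∑ d ∈ q.divisors, (ArithmeticFunction.moebius (q / d) : ℝ) * (d : ℝ) ^ k := by
  rw [← Nat.sum_div_divisors q (fun d => (ArithmeticFunction.moebius (q / d) : ℝ) * (d : ℝ) ^ k)]
  have h1 : ∀ d ∈ q.divisors, (ArithmeticFunction.moebius (q / (q / d)) : ℝ) *
      ((q / d : ℕ) : ℝ) ^ k =
      (q : ℝ) ^ k * ((ArithmeticFunction.moebius d : ℝ) * (1 / (d : ℝ) ^ k)) := by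
    intro d hd
    have hdq := Nat.dvd_of_mem_divisors hd
    have hd0 : (d : ℝ) ≠ 0 := by exact_mod_cast (Nat.pos_of_mem_divisors hd).ne'
    rw [Nat.div_div_self hdq hq, Nat.cast_div hdq hd0, div_pow]
    ring
  rw [sum_congr rfl h1, ← mul_sum, jordanTotient]
  congr 1
  have h2 : ∑ d ∈ q.divisors, (ArithmeticFunction.moebius d : ℝ) * (1 / (d : ℝ) ^ k) =
      ∑ d ∈ q.divisors with Squarefree d,
        (ArithmeticFunction.moebius d : ℝ) * (1 / (d : ℝ) ^ k) := by
    rw [sum_filter]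
    refine sum_congr rfl fun d _ => ?_
    split_ifs with h
    · rfl
    · simp [ArithmeticFunction.moebius_eq_zero_of_not_squarefree h]
  rw [h2, Nat.sum_divisors_filter_squarefree hq]
  have h3 : (UniqueFactorizationMonoid.normalizedFactors q).toFinset = q.primeFactors := by
    ext p
    rw [Nat.factors_eq]
    simp
  simp_rw [h3, sub_eq_add_neg]
  rw [prod_one_add]
  refine sum_congr rfl fun t ht => ?_
  have ht' := mem_powerset.mp ht
  have h4 : t.val.prod = ∏ p ∈ t, p := by rw [Finset.prod_eq_multiset_prod]; simp
  rw [h4, ArithmeticFunction.isMultiplicative_moebius.map_prod_of_subset_primeFactors _ _ ht']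
  push_cast
  rw [← prod_pow, one_div, ← prod_inv_distrib, ← prod_mul_distrib]
  refine prod_congr rfl fun p hp => ?_
  rw [ArithmeticFunction.moebius_apply_prime (Nat.prime_of_mem_primeFactors (ht' hp))]
  simp

theorem jordanTotient_one (q : ℕ) : jordanTotient 1 q = q.totient := by
  have h := congrArg (Rat.cast : ℚ → ℝ) (Nat.totient_eq_mul_prod_factors q)
  push_cast at h
  rw [h, jordanTotient]
  simp

theorem sum_moebius_div {q : ℕ} (hq : 2 ≤ q) :
    ∑ d ∈ q.divisors, (ArithmeticFunction.moebius (q / d) : ℝ) = 0 := by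
  rw [Nat.sum_div_divisors q (fun d => (ArithmeticFunction.moebius d : ℝ))]
  have h := congrArg (fun f => f q) ArithmeticFunction.moebius_mul_coe_zeta
  rw [ArithmeticFunction.coe_mul_zeta_apply, ArithmeticFunction.one_apply_ne (by omega)] at h
  exact_mod_cast h

theorem sum_antidiagonal_eq_sum_Icc {M : Type*} [AddCommMonoid M] (n : ℕ) (f : ℕ → ℕ → M)
    (h0 : f n 0 = 0) : ∑ p ∈ antidiagonal n, f p.1 p.2 = ∑ j ∈ Icc 1 n, f (n - j) j := by
  rw [← Finset.Nat.sum_antidiagonal_swap]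
  simp only [Prod.fst_swap, Prod.snd_swap]
  rw [Finset.Nat.sum_antidiagonal_eq_sum_range_succ (fun i j => f j i), sum_range_succ',
    Nat.sub_zero, h0, add_zero, range_eq_Ico, Finset.sum_Ico_add' (fun j => f (n - j) j)]
  rfl

/-- Converts the coefficients of the B_k/k! normalization into those of the final formula. -/
theorem multichoose_mul_factorial {m n j : ℕ} (hm : 1 ≤ m) (hj : j ≤ n) :
    (m.factorial : ℝ) * n.factorial * m.multichoose (n - j) =
      m * n.choose j / ((m : ℝ) + n - j) * (j.factorial * (m + n - j).factorial) := by
  obtain ⟨i, rfl⟩ := Nat.exists_eq_add_of_le hj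
  obtain ⟨k, rfl⟩ := Nat.exists_eq_add_of_le' hm
  rw [Nat.add_sub_cancel_left, Nat.multichoose_eq, show k + 1 + i - 1 = i + k by omega,
    show k + 1 + (j + i) - j = i + k + 1 by omega, Nat.factorial_succ, Nat.factorial_succ,
    Nat.choose_symm_add, Nat.choose_symm_add, Nat.add_choose, Nat.add_choose, Nat.cast_div (Nat.factorial_mul_factorial_dvd_factorial_add _ _)
      (by positivity),
    Nat.cast_div (Nat.factorial_mul_factorial_dvd_factorial_add _ _) (by positivity)]
  have : ((k + 1 : ℕ) : ℝ) + (j + i : ℕ) - j = i + k + 1 := by push_cast; ring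
  rw [this]
  have : (i : ℝ) + k + 1 ≠ 0 := by positivity
  push_cast
  field_simp

theorem bernoulliBar_neg (k : ℕ) (x : ℝ) : bernoulliBar k (-x) = (-1) ^ k * bernoulliBar k x := by
  rw [bernoulliBar_eq_factorial_mul, normBernoulliBar_neg, bernoulliBar_eq_factorial_mul]
  ring

theorem bernoulliBar_add_intCast (k : ℕ) (x : ℝ) (N : ℤ) :
    bernoulliBar k (x + N) = bernoulliBar k x := by
  simp only [bernoulliBar, Int.fract_add_intCast]

theorem bernoulliBar_zero_right {k : ℕ} (hk : k ≠ 1) : bernoulliBar k 0 = bernoulli k := by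
  rw [bernoulliBar, if_neg (fun h => hk h.1), Int.fract_zero, bernoulliFun_eval_zero]

theorem sum_range_bernoulliBar_eq_sum_Icc (a : ℕ) [NeZero a] (g : ℝ → ℝ)
    (hg : Function.Periodic g 1) :
    ∑ l ∈ range a, g ((l : ℝ) / a) = ∑ l ∈ Icc 1 a, g ((l : ℝ) / a) := by
  simpa using (sum_Icc_eq_sum_range_of_periodic (periodic_comp_div hg a 0)).symm

/-- Each d ∣ q is coprime to a, so l ↦ dl permutes the residues modulo a and the inner sum does not
depend on d. -/
theorem sum_moebius_mul_normBernoulliBar {q a k : ℕ} [NeZero a] (hq : 2 ≤ q) (haq : a.Coprime q) :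
    ∑ d ∈ q.divisors, (ArithmeticFunction.moebius (q / d) : ℝ) *
      ∑ l ∈ range a, normBernoulliBar k (d * (l / a)) = 0 := by
  have h : ∀ d ∈ q.divisors, ∑ l ∈ range a, normBernoulliBar k (d * (l / a)) =
      ∑ l ∈ range a, normBernoulliBar k (l / a) := by
    intro d hd
    have hda : d.Coprime a := (Nat.Coprime.coprime_dvd_right (Nat.dvd_of_mem_divisors hd) haq).symm
    have hp := periodic_comp_div (f := normBernoulliBar k) (e := a)
      (fun x => by simpa using normBernoulliBar_add_intCast k x 1) 0
    have := sum_range_comp_mul_of_periodic hp hda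
    push_cast at this
    simpa [mul_div_assoc] using this
  rw [sum_congr rfl fun d hd => by rw [h d hd], ← sum_mul, sum_moebius_div hq, zero_mul]

/-- The Möbius-weighted reciprocity law. -/
theorem sum_moebius_mul_dedekindSum {q m n a : ℕ} (hq : 2 ≤ q) (hm : 1 ≤ m) (hn : 1 ≤ n)
    (ha : 1 ≤ a) (haq : a.Coprime q) :
    (m.factorial : ℝ) * n.factorial * ∑ d ∈ q.divisors,
      (ArithmeticFunction.moebius (q / d) : ℝ) * ((d : ℝ) ^ (m + n) / d * dedekindSum m n a d) =
    (n : ℝ) * ∑ j ∈ Finset.Icc 1 m,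
              (Nat.choose m j : ℝ) * ((-1 : ℝ) ^ j * (a : ℝ) ^ (m - j) / ((m : ℝ) + n - j)) *
                bernoulliBar j 0 * bernoulliBar (m + n - j) 0 * jordanTotient j q
          + (m : ℝ) * (a : ℝ) ^ (m - 1) * ∑ j ∈ Finset.Icc 1 n,
              (Nat.choose n j : ℝ) * ((-1 : ℝ) ^ j / ((m : ℝ) + n - j)) *
                ∑ l ∈ Finset.Icc 1 a, bernoulliBar j ((l : ℝ) / a) *
                  ∑ d ∈ q.divisors, (ArithmeticFunction.moebius (q / d) : ℝ) * (d : ℝ) ^ j *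
                    bernoulliBar (m + n - j) ((d : ℝ) * l / a)
          + (-1 : ℝ) ^ (n - 1) * (Nat.factorial m : ℝ) * (Nat.factorial n : ℝ) *
              (bernoulli (m + n) : ℝ) * jordanTotient (m + n) q /
                ((a : ℝ) ^ n * (Nat.factorial (m + n) : ℝ))
          - (if m = 1 ∧ n = 1 then 1 else 0) * (Nat.totient q : ℝ) / 4 := by
  have hq0 : q ≠ 0 := by omega
  have : NeZero a := ⟨by omega⟩
  have h := sum_congr rfl fun d (hd : d ∈ q.divisors) => by
    have : NeZero d := ⟨(Nat.pos_of_mem_divisors hd).ne'⟩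
    exact congrArg ((ArithmeticFunction.moebius (q / d) : ℝ) * ·)
      (dedekindSum_reciprocity hm hn a d)
  rw [h]
  simp only [mul_sub, mul_add, sum_sub_distrib, sum_add_distrib]
  have t1 : (m.factorial : ℝ) * n.factorial * ∑ d ∈ q.divisors,
      (ArithmeticFunction.moebius (q / d) : ℝ) * (a ^ m / a * ∑ p ∈ antidiagonal n, (-1) ^ p.2 *
        (m.multichoose p.1 : ℝ) * (d ^ p.2 *
        ∑ l ∈ range a, normBernoulliBar p.2 (l / a) * normBernoulliBar (m + p.1) (d * (l / a)))) =
      (m : ℝ) * (a : ℝ) ^ (m - 1) * ∑ j ∈ Finset.Icc 1 n,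
              (Nat.choose n j : ℝ) * ((-1 : ℝ) ^ j / ((m : ℝ) + n - j)) *
                ∑ l ∈ Finset.Icc 1 a, bernoulliBar j ((l : ℝ) / a) *
                  ∑ d ∈ q.divisors, (ArithmeticFunction.moebius (q / d) : ℝ) * (d : ℝ) ^ j *
                    bernoulliBar (m + n - j) ((d : ℝ) * l / a) := by
    have ha' : (a : ℝ) ^ m / a = a ^ (m - 1) := by
      rw [pow_sub₀ _ (NeZero.ne _) hm, pow_one]; rfl
    rw [ha']
    simp_rw [mul_left_comm _ ((a : ℝ) ^ (m - 1)), ← mul_sum]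
    simp_rw [mul_sum (s := antidiagonal n)]
    rw [sum_comm, sum_antidiagonal_eq_sum_Icc n (fun i j => ∑ d ∈ q.divisors,
      (ArithmeticFunction.moebius (q / d) : ℝ) * ((-1) ^ j * (m.multichoose i : ℝ) * (d ^ j *
        ∑ l ∈ range a, normBernoulliBar j (l / a) * normBernoulliBar (m + i) (d * (l / a)))))]
    · rw [mul_sum, mul_sum, mul_sum]
      refine sum_congr rfl fun j hj => ?_
      obtain ⟨hj1, hjn⟩ := mem_Icc.mp hj
      have hper := sum_range_bernoulliBar_eq_sum_Icc a (fun x => bernoulliBar j x *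
        ∑ d ∈ q.divisors, (ArithmeticFunction.moebius (q / d) : ℝ) * (d : ℝ) ^ j *
          bernoulliBar (m + n - j) ((d : ℝ) * x)) (by
        intro x
        have h1 := bernoulliBar_add_intCast j x 1
        have h2 : ∀ d : ℕ, bernoulliBar (m + n - j) (d * (x + 1)) =
            bernoulliBar (m + n - j) (d * x) := by
          intro d
          have := bernoulliBar_add_intCast (m + n - j) (d * x) d
          rw [← this]
          push_cast
          congr 1
          ring
        push_cast at h1
        simp only [h1, h2])
      simp only [mul_div_assoc] at hper ⊢
      rw [← hper]
      have hmc := multichoose_mul_factorial hm hjn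
      rw [show m + (n - j) = m + n - j by omega]
      simp only [bernoulliBar_eq_factorial_mul, mul_sum (s := q.divisors)]
      rw [sum_comm]
      simp only [mul_sum]
      refine sum_congr rfl fun d _ => sum_congr rfl fun l _ => ?_
      linear_combination (a ^ (m - 1) * (ArithmeticFunction.moebius (q / d) : ℝ) * (-1) ^ j *
        d ^ j * normBernoulliBar j (l / a) * normBernoulliBar (m + n - j) (d * (l / a))) * hmc
    -- The j = 0 term vanishes, which is why the sum can start at j = 1.
    · have := sum_moebius_mul_normBernoulliBar (k := m + n) hq haq
      simp only [pow_zero, one_mul, normBernoulliBar_zero_left]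
      simp_rw [mul_left_comm _ ((m.multichoose n : ℕ) : ℝ), ← mul_sum]
      rw [this, mul_zero]
  have t2 : (m.factorial : ℝ) * n.factorial * ∑ d ∈ q.divisors,
      (ArithmeticFunction.moebius (q / d) : ℝ) * ∑ p ∈ antidiagonal m, (n.multichoose p.1 : ℝ) *
        a ^ p.1 * d ^ p.2 * normBernoulliBar p.2 0 * normBernoulliBar (n + p.1) 0 =
      (n : ℝ) * ∑ j ∈ Finset.Icc 1 m,
              (Nat.choose m j : ℝ) * ((-1 : ℝ) ^ j * (a : ℝ) ^ (m - j) / ((m : ℝ) + n - j)) *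
                bernoulliBar j 0 * bernoulliBar (m + n - j) 0 * jordanTotient j q := by
    simp_rw [mul_sum (s := antidiagonal m)]
    rw [sum_comm, sum_antidiagonal_eq_sum_Icc m (fun i j => ∑ d ∈ q.divisors,
      (ArithmeticFunction.moebius (q / d) : ℝ) * ((n.multichoose i : ℝ) *
        a ^ i * d ^ j * normBernoulliBar j 0 * normBernoulliBar (n + i) 0))]
    · rw [mul_sum, mul_sum]
      refine sum_congr rfl fun j hj => ?_
      obtain ⟨hj1, hjm⟩ := mem_Icc.mp hj
      have hmc := multichoose_mul_factorial hn hjm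
      -- The sign (-1)^j is harmless, since B̄_j(0) = 0 for odd j.
      have hs : (-1 : ℝ) ^ j * bernoulliBar j 0 = bernoulliBar j 0 := by
        rw [← bernoulliBar_neg, neg_zero]
      rw [show n + (m - j) = m + n - j by omega, jordanTotient_eq_sum hq0]
      rw [add_comm n m, add_comm (n : ℝ)] at hmc
      have hs' : (Nat.choose m j : ℝ) * ((-1 : ℝ) ^ j * (a : ℝ) ^ (m - j) / ((m : ℝ) + n - j)) *
                bernoulliBar j 0 = (Nat.choose m j : ℝ) * ((a : ℝ) ^ (m - j) / ((m : ℝ) + n - j)) *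
                bernoulliBar j 0 := by
        linear_combination (Nat.choose m j : ℝ) * ((a : ℝ) ^ (m - j) / ((m : ℝ) + n - j)) * hs
      rw [hs']
      simp only [bernoulliBar_eq_factorial_mul, mul_sum]
      refine sum_congr rfl fun d _ => ?_
      linear_combination (a ^ (m - j) * (ArithmeticFunction.moebius (q / d) : ℝ) *
          d ^ j * normBernoulliBar j 0 * normBernoulliBar (m + n - j) 0) * hmc
    · simp only [pow_zero]
      rw [← sum_mul, sum_moebius_div hq, zero_mul]
  have t3 : (m.factorial : ℝ) * n.factorial * ∑ d ∈ q.divisors,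
      (ArithmeticFunction.moebius (q / d) : ℝ) * ((-1) ^ n * d ^ (m + n) / a ^ n *
        normBernoulliBar (m + n) 0) = -((-1 : ℝ) ^ (n - 1) * (Nat.factorial m : ℝ) *
        (Nat.factorial n : ℝ) * (bernoulli (m + n) : ℝ) * jordanTotient (m + n) q /
                ((a : ℝ) ^ n * (Nat.factorial (m + n) : ℝ))) := by
    obtain ⟨k, rfl⟩ := Nat.exists_eq_add_of_le' hn
    rw [← bernoulliBar_zero_right (k := m + (k + 1)) (by omega), bernoulliBar_eq_factorial_mul,
      jordanTotient_eq_sum hq0, Nat.add_sub_cancel]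
    simp only [mul_sum, sum_div, ← sum_neg_distrib]
    refine sum_congr rfl fun d _ => ?_
    have : (a : ℝ) ≠ 0 := NeZero.ne _
    field_simp
    ring
  have t4 : (m.factorial : ℝ) * n.factorial * ∑ d ∈ q.divisors,
      (ArithmeticFunction.moebius (q / d) : ℝ) * (if m = 1 ∧ n = 1 then (d : ℝ) / 4 else 0) =
      (if m = 1 ∧ n = 1 then 1 else 0) * (Nat.totient q : ℝ) / 4 := by
    split_ifs with h
    · obtain ⟨rfl, rfl⟩ := h
      rw [← jordanTotient_one, jordanTotient_eq_sum hq0]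
      simp [mul_div_assoc, sum_div]
    · simp
  rw [t1, t2, t3, t4]
  ring

end

/-! ### The odd Hurwitz zeta function at s = 1. -/

section

open Finset Filter Topology

theorem abs_rpow_neg_sub_rpow_neg_le {c u v s : ℝ} (hc : 0 < c) (hu : c ≤ u) (hv : c ≤ v)
    (hs : 0 ≤ s) : |u ^ (-s) - v ^ (-s)| ≤ s * c ^ (-s - 1) * |u - v| := by
  have := (convex_Ici c).norm_image_sub_le_of_norm_hasDerivWithin_le (𝕜 := ℝ) (f := fun x => x ^ (-s))
    (f' := fun x => (-s) * x ^ (-s - 1)) (C := s * c ^ (-s - 1)) (x := v) (y := u) ?_ ?_ hv hu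
  · simpa only [Real.norm_eq_abs] using this
  · intro x hx
    exact (Real.hasDerivAt_rpow_const (Or.inl (hc.trans_le hx).ne')).hasDerivWithinAt
  · intro x hx
    rw [norm_mul, norm_neg, Real.norm_of_nonneg hs,
      Real.norm_of_nonneg (Real.rpow_nonneg (hc.le.trans hx) _)]
    exact mul_le_mul_of_nonneg_left (Real.rpow_le_rpow_of_nonpos hc hx (by linarith)) hs

theorem hurwitzZetaOdd_eq_tsum_ofReal {a : ℝ} (ha : a ∈ Set.Ioo 0 1) {s : ℝ} (hs : 1 < s) :
    HurwitzZeta.hurwitzZetaOdd a s =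
      ((∑' n : ℕ, ((n + a) ^ (-s) - (n + 1 - a) ^ (-s)) / 2 : ℝ) : ℂ) := by
  rw [← (HurwitzZeta.hasSum_nat_hurwitzZetaOdd_of_mem_Icc (Set.Ioo_subset_Icc_self ha)
    (s := s) (by simpa using hs)).tsum_eq, Complex.ofReal_tsum]
  refine tsum_congr fun n => ?_
  have h1 : (0 : ℝ) ≤ n + a := add_nonneg n.cast_nonneg ha.1.le
  have h2 : (0 : ℝ) ≤ n + 1 - a := by linarith [ha.2, n.cast_nonneg (α := ℝ)]
  push_cast
  rw [Complex.ofReal_cpow h1, Complex.ofReal_cpow h2]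
  push_cast
  rw [Complex.cpow_neg, Complex.cpow_neg, one_div, one_div]

/-- The series is known for s > 1. Paired terms are O(n⁻²) uniformly for 1 ≤ s ≤ 2, so dominated
convergence and continuity of the odd zeta function carry it to s = 1. -/
theorem hasSum_hurwitzZetaOdd_one {a : ℝ} (ha : a ∈ Set.Ioo 0 1) :
    HasSum (fun n : ℕ => ((n + a : ℂ)⁻¹ - (n + 1 - a : ℂ)⁻¹) / 2)
      (HurwitzZeta.hurwitzZetaOdd a 1) := by
  -- Since c ≤ 1, both n + a and n + 1 - a are at least c(n + 1), which yields the majorant.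
  set c := min a (1 - a) with hc
  have hc0 : 0 < c := lt_min ha.1 (by linarith [ha.2])
  have hc1 : c ≤ 1 := (min_le_left _ _).trans ha.2.le
  set f : ℝ → ℕ → ℝ := fun s n => ((n + a) ^ (-s) - (n + 1 - a) ^ (-s)) / 2 with hf
  set bound : ℕ → ℝ := fun n => c ^ (-3 : ℝ) * (n + 1 : ℝ) ^ (-2 : ℝ) with hbound
  have hb : Summable bound := by
    refine Summable.mul_left _ ?_
    have := (summable_nat_add_iff 1).mpr (Real.summable_nat_rpow.mpr (show (-2 : ℝ) < -1 by norm_num))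
    simpa using this
  have hfb : ∀ s ∈ Set.Icc (1 : ℝ) 2, ∀ n, ‖f s n‖ ≤ bound n := by
    intro s hs n
    have hn : (0 : ℝ) ≤ n := n.cast_nonneg
    have hcn : c * (n + 1) ≤ n + c := by nlinarith
    have hcn0 : 0 < c * (n + 1) := by positivity
    have h1 : c * (n + 1) ≤ n + a := hcn.trans (by linarith [min_le_left a (1 - a)])
    have h2 : c * (n + 1) ≤ n + 1 - a := hcn.trans (by linarith [min_le_right a (1 - a)])
    have h3 := abs_rpow_neg_sub_rpow_neg_le (s := s) hcn0 h1 h2 (by linarith [hs.1])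
    have h4 : |(n : ℝ) + a - (n + 1 - a)| ≤ 1 := by
      rw [abs_le]
      constructor <;> linarith [ha.1, ha.2]
    have h5 : (c * (n + 1)) ^ (-s - 1) ≤ c ^ (-3 : ℝ) * (n + 1 : ℝ) ^ (-2 : ℝ) := by
      rw [Real.mul_rpow hc0.le (by positivity)]
      refine mul_le_mul ?_ ?_ (by positivity) (by positivity)
      · exact Real.rpow_le_rpow_of_exponent_ge hc0 hc1 (by linarith [hs.2])
      · exact Real.rpow_le_rpow_of_exponent_le (by linarith) (by linarith [hs.1])
    simp only [hf, norm_div, Real.norm_eq_abs, hbound]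
    rw [abs_of_pos (show (0 : ℝ) < 2 by norm_num), div_le_iff₀ (by norm_num)]
    calc _ ≤ _ := h3
      _ ≤ s * (c * (n + 1)) ^ (-s - 1) * 1 :=
        mul_le_mul_of_nonneg_left h4 (mul_nonneg (by linarith [hs.1]) (by positivity))
      _ ≤ 2 * (c ^ (-3 : ℝ) * (n + 1 : ℝ) ^ (-2 : ℝ)) := by
        rw [mul_one]
        exact mul_le_mul hs.2 h5 (by positivity) (by norm_num)
      _ = _ := mul_comm _ _
  have hlim : Tendsto (fun s => ∑' n, f s n) (𝓝[>] 1) (𝓝 (∑' n, f 1 n)) := by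
    refine tendsto_tsum_of_dominated_convergence hb (fun n => ?_) ?_
    · refine tendsto_nhdsWithin_of_tendsto_nhds (ContinuousAt.tendsto ?_)
      have h1 : (n : ℝ) + a ≠ 0 := by linarith [ha.1, n.cast_nonneg (α := ℝ)]
      have h2 : (n : ℝ) + 1 - a ≠ 0 := by linarith [ha.2, n.cast_nonneg (α := ℝ)]
      simp only [hf]
      exact ((Real.continuousAt_const_rpow h1).comp continuousAt_neg |>.sub
        ((Real.continuousAt_const_rpow h2).comp continuousAt_neg)).div_const _
    · filter_upwards [Ioc_mem_nhdsGT (show (1 : ℝ) < 2 by norm_num)] with s hs n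
      exact hfb s ⟨hs.1.le, hs.2⟩ n
  have hlim2 : Tendsto (fun s : ℝ => HurwitzZeta.hurwitzZetaOdd a s) (𝓝[>] 1)
      (𝓝 (HurwitzZeta.hurwitzZetaOdd a 1)) := by
    have := (HurwitzZeta.differentiable_hurwitzZetaOdd a).continuous.comp Complex.continuous_ofReal
    simpa [Function.comp_def] using (this.tendsto 1).mono_left nhdsWithin_le_nhds
  have heq : HurwitzZeta.hurwitzZetaOdd a 1 = ((∑' n, f 1 n : ℝ) : ℂ) := by
    refine tendsto_nhds_unique hlim2 (((Complex.continuous_ofReal.tendsto _).comp hlim).congr' ?_)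
    filter_upwards [self_mem_nhdsWithin] with s hs
    exact (hurwitzZetaOdd_eq_tsum_ofReal ha hs).symm
  rw [heq]
  have hsum : HasSum (f 1) (∑' n, f 1 n) :=
    (Summable.of_norm_bounded hb (hfb 1 (by norm_num))).hasSum
  have := Complex.hasSum_ofReal.mpr hsum
  refine this.congr_fun fun n => ?_
  simp only [hf, Real.rpow_neg_one]
  push_cast
  rfl

/-- The odd Hurwitz zeta function at `s = 1`. -/
theorem hurwitzZetaOdd_one {a : ℝ} (ha : a ∈ Set.Ioo 0 1) :
    HurwitzZeta.hurwitzZetaOdd a 1 = Real.pi / 2 * Complex.cot (Real.pi * a) := by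
  have hz : (a : ℂ) ∈ Complex.integerComplement := by
    rintro ⟨n, hn⟩
    have hn' : (n : ℝ) = a := by exact_mod_cast hn
    have h0 : (0 : ℝ) < n := hn' ▸ ha.1
    have h1 : (n : ℝ) < 1 := hn' ▸ ha.2
    norm_cast at h0 h1
    omega
  have h1 := (summable_cotTerm hz).hasSum.tendsto_sum_nat
  have h2 := (hasSum_hurwitzZetaOdd_one ha).tendsto_sum_nat
  have h3 : (∑' n, cotTerm (a : ℂ) n) = Real.pi * Complex.cot (Real.pi * a) - 1 / a :=
    (cot_series_rep' hz).symm
  rw [h3] at h1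
  -- Regrouping turns the partial sums into those of the cotangent expansion, up to a boundary term
  -- tending to 0.
  have hN : ∀ N : ℕ, ∑ n ∈ range N, ((n + a : ℂ)⁻¹ - (n + 1 - a : ℂ)⁻¹) / 2 =
      (1 / a + ∑ n ∈ range N, cotTerm (a : ℂ) n - ((a : ℂ) + N)⁻¹) / 2 := by
    intro N
    induction N with
    | zero => simp
    | succ N ih =>
      rw [sum_range_succ, sum_range_succ, ih, cotTerm]
      have : ((a : ℂ) - (N + 1)) = -(N + 1 - a) := by ring
      rw [this, one_div, one_div, inv_neg]
      push_cast
      rw [add_comm (N : ℂ) a]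
      ring
  have hinv : Tendsto (fun N : ℕ => ((a : ℂ) + N)⁻¹) atTop (𝓝 0) := by
    have h : Tendsto (fun N : ℕ => (a + N : ℝ)⁻¹) atTop (𝓝 0) :=
      tendsto_inv_atTop_zero.comp (tendsto_atTop_add_const_left _ _ tendsto_natCast_atTop_atTop)
    have := (Complex.continuous_ofReal.tendsto 0).comp h
    simpa [Function.comp_def] using this
  have h4 := ((h1.const_add (1 / (a : ℂ))).sub hinv).div_const 2
  rw [funext hN] at h2
  rw [tendsto_nhds_unique h2 h4]
  ring

end

/-! ### Special L-values through finite Fourier transforms of Bernoulli functions. -/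

section

open Finset ZMod HurwitzZeta
open scoped Real

theorem eval_map_bernoulli_ofReal (k : ℕ) (x : ℝ) :
    ((Polynomial.bernoulli k).map (algebraMap ℚ ℂ)).eval (x : ℂ) = (bernoulliFun k x : ℂ) := by
  rw [bernoulliFun, ← Complex.ofRealHom_eq_coe, ← Complex.ofRealHom_eq_coe, ← Polynomial.eval_map_apply,
    Polynomial.map_map]
  rfl

theorem bernoulliBar_of_mem_Ico {k : ℕ} (hk : k ≠ 1) {x : ℝ} (hx : x ∈ Set.Ico (0 : ℝ) 1) :
    bernoulliBar k x = bernoulliFun k x := by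
  rw [bernoulliBar, if_neg (fun h => hk h.1), Int.fract_eq_self.mpr hx]

theorem cosZeta_even {m : ℕ} (hm : 2 ≤ m) (he : Even m) {x : ℝ} (hx : x ∈ Set.Ico (0 : ℝ) 1) :
    cosZeta x m = -(2 * π * Complex.I) ^ m / (2 * m.factorial) * bernoulliBar m x := by
  obtain ⟨k, rfl⟩ := he.two_dvd
  have h := cosZeta_two_mul_nat (k := k) (by omega) (Set.Ico_subset_Icc_self hx)
  rw [eval_map_bernoulli_ofReal, ← bernoulliBar_of_mem_Ico (by omega) hx] at h
  push_cast at h ⊢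
  rw [h, mul_pow _ Complex.I, pow_mul Complex.I, Complex.I_sq]
  ring

/-- The factor I makes the constant the same as for even m, so that both parities share one formula.
-/
theorem sinZeta_odd {m : ℕ} (hm : 2 ≤ m) (ho : Odd m) {x : ℝ} (hx : x ∈ Set.Ico (0 : ℝ) 1) :
    Complex.I * sinZeta x m =
      -(2 * π * Complex.I) ^ m / (2 * m.factorial) * bernoulliBar m x := by
  obtain ⟨k, rfl⟩ := ho
  have h := sinZeta_two_mul_nat_add_one (k := k) (by omega) (Set.Ico_subset_Icc_self hx)
  rw [eval_map_bernoulli_ofReal, ← bernoulliBar_of_mem_Ico (by omega) hx] at h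
  push_cast at h ⊢
  rw [h, mul_pow _ Complex.I, pow_succ Complex.I, pow_mul Complex.I, Complex.I_sq]
  ring

theorem val_div_mem_Ico {q : ℕ} [NeZero q] (j : ZMod q) :
    ((j.val : ℝ) / q) ∈ Set.Ico (0 : ℝ) 1 := by
  have hq : (0 : ℝ) < q := by exact_mod_cast NeZero.pos q
  refine ⟨by positivity, ?_⟩
  rw [div_lt_one hq]
  exact_mod_cast ZMod.val_lt j

/-- The Bernoulli function `B̄_k(j / q)` for `j` a residue class modulo `q`. -/
noncomputable def bernoulliZMod (q k : ℕ) (j : ZMod q) : ℝ := bernoulliBar k (j.val / q)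

theorem bernoulliZMod_intCast {q : ℕ} [NeZero q] (k : ℕ) (t : ℤ) :
    bernoulliZMod q k t = bernoulliBar k (t / q) := by
  have hp := periodic_comp_div (f := bernoulliBar k) (e := q)
    (fun x => by simpa using bernoulliBar_add_intCast k x 1) 0
  simpa [bernoulliZMod] using apply_val_intCast_of_periodic hp t

theorem bernoulliZMod_neg {q : ℕ} [NeZero q] (k : ℕ) (j : ZMod q) :
    bernoulliZMod q k (-j) = (-1) ^ k * bernoulliZMod q k j := by
  have h := bernoulliZMod_intCast (q := q) k (-(j.val : ℤ))
  have h2 := bernoulliZMod_intCast (q := q) k (j.val : ℤ)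
  push_cast at h h2
  rw [natCast_zmod_val] at h h2
  rw [h, h2, neg_div, bernoulliBar_neg]

/-- The L-function of a transform is a combination of exponential zeta values; the parity of Ψ kills
the cosine or the sine part, and the other is a Bernoulli function. -/
theorem LFunction_dft_of_two_le {q m : ℕ} [NeZero q] (hm : 2 ≤ m) {Ψ : ZMod q → ℂ}
    (hΨ : ∀ j, Ψ (-j) = (-1) ^ m * Ψ j) :
    ZMod.LFunction (𝓕 Ψ) m = (-1) ^ m * (-(2 * π * Complex.I) ^ m / (2 * m.factorial)) *
      ∑ j, Ψ j * bernoulliZMod q m j := by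
  have hm1 : (m : ℂ) ≠ 1 := by exact_mod_cast (by omega : m ≠ 1)
  rw [LFunction_dft _ (Or.inr hm1)]
  have h1 : ∑ j : ZMod q, Ψ j * expZeta (toAddCircle (-j)) m =
      (-1) ^ m * ∑ j : ZMod q, Ψ j * expZeta (toAddCircle j) m := by
    rw [← Equiv.sum_comp (Equiv.neg _), mul_sum]
    refine sum_congr rfl fun j _ => ?_
    rw [Equiv.neg_apply, neg_neg, hΨ, mul_assoc]
  have h2 : ∑ j : ZMod q, Ψ j * expZeta (toAddCircle j) m = ∑ j : ZMod q, Ψ j *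
      (-(2 * π * Complex.I) ^ m / (2 * m.factorial) * bernoulliZMod q m j) := by
    simp only [expZeta, mul_add, sum_add_distrib]
    rcases Nat.even_or_odd m with he | ho
    · have h3 : ∑ j : ZMod q, Ψ j * (Complex.I * sinZeta (toAddCircle j) m) = 0 := by
        rw [← self_eq_neg, ← sum_neg_distrib, ← Equiv.sum_comp (Equiv.neg _)]
        refine sum_congr rfl fun j _ => ?_
        rw [Equiv.neg_apply, hΨ, map_neg, sinZeta_neg, he.neg_one_pow]
        ring
      rw [h3, add_zero]
      refine sum_congr rfl fun j _ => ?_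
      rw [toAddCircle_apply, cosZeta_even hm he (val_div_mem_Ico j), bernoulliZMod]
    · have h3 : ∑ j : ZMod q, Ψ j * cosZeta (toAddCircle j) m = 0 := by
        rw [← self_eq_neg, ← sum_neg_distrib, ← Equiv.sum_comp (Equiv.neg _)]
        refine sum_congr rfl fun j _ => ?_
        rw [Equiv.neg_apply, hΨ, map_neg, cosZeta_neg, ho.neg_one_pow]
        ring
      rw [h3, zero_add]
      refine sum_congr rfl fun j _ => ?_
      rw [toAddCircle_apply, sinZeta_odd hm ho (val_div_mem_Ico j), bernoulliZMod]
  rw [h1, h2, mul_sum, mul_sum]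
  refine sum_congr rfl fun j _ => ?_
  ring

/-- The discrete Fourier transform of the Bernoulli function `h ↦ B̄_k(h / q)`. -/
noncomputable def bernoulliDFT (q k : ℕ) [NeZero q] (r : ZMod q) : ℂ :=
  ∑ h : ZMod q, stdAddChar (h * r) * bernoulliZMod q k h

theorem sub_one_mul_sum_natCast_mul_pow (w : ℂ) (N : ℕ) :
    (w - 1) * ∑ h ∈ range N, h * w ^ h = N * w ^ N - w * ∑ h ∈ range N, w ^ h := by
  induction N with
  | zero => simp
  | succ N ih =>
    rw [sum_range_succ, sum_range_succ, mul_add, ih]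
    push_cast
    ring

theorem bernoulliZMod_one {q : ℕ} [NeZero q] (h : ZMod q) :
    bernoulliZMod q 1 h = (h.val : ℝ) / q - 1 / 2 + if h = 0 then 1 / 2 else 0 := by
  have hq : (q : ℝ) ≠ 0 := NeZero.ne _
  rw [bernoulliZMod, bernoulliBar, Int.fract_eq_self.mpr (val_div_mem_Ico h), bernoulliFun_one]
  by_cases h0 : h = 0
  · simp [h0]
  · have hv : (h.val : ℝ) ≠ 0 := by exact_mod_cast (ZMod.val_ne_zero h).mpr h0
    rw [if_neg (fun h => div_ne_zero hv hq h.2), if_neg h0, add_zero]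

/-- With w = e^{2πir/q} ≠ 1, ∑ w^h = 0 and ∑ h w^h = q/(w - 1). The transform is therefore 1/(w - 1)
+ 1/2 = (w + 1)/(2(w - 1)), a cotangent. -/
theorem bernoulliDFT_one {q : ℕ} [NeZero q] {r : ZMod q} (hr : r ≠ 0) :
    bernoulliDFT q 1 r = -(Complex.I / 2) * Complex.cot (π * (r.val / q : ℝ)) := by
  have hq : (q : ℂ) ≠ 0 := NeZero.ne _
  set w : ℂ := stdAddChar r with hw
  have hw1 : w ≠ 1 := by
    intro h
    have := injective_stdAddChar (h.trans (AddChar.map_zero_eq_one stdAddChar).symm)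
    exact hr this
  have hwq : w ^ q = 1 := by
    rw [hw, ← AddChar.map_nsmul_eq_pow]
    simp
  have hgeom : ∑ h ∈ range q, w ^ h = 0 := by
    have := geom_sum_mul w q
    rw [hwq, sub_self] at this
    exact (mul_eq_zero.mp this).resolve_right (sub_ne_zero.mpr hw1)
  have hS := sub_one_mul_sum_natCast_mul_pow w q
  rw [hgeom, hwq, mul_zero, sub_zero, mul_one] at hS
  have hD : bernoulliDFT q 1 r = (∑ h ∈ range q, h * w ^ h) / q + 1 / 2 := by
    have h1 : ∀ h : ZMod q, stdAddChar (h * r) * (bernoulliZMod q 1 h : ℂ) =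
        (h.val * w ^ h.val) / q - 1 / 2 * w ^ h.val + if h = 0 then 1 / 2 else 0 := by
      intro h
      have : stdAddChar (h * r) = w ^ h.val := by
        rw [hw, ← AddChar.map_nsmul_eq_pow, nsmul_eq_mul, natCast_zmod_val]
      rw [this, bernoulliZMod_one]
      split_ifs with h0
      · simp [h0]
      · push_cast
        ring
    rw [bernoulliDFT, sum_congr rfl fun h _ => h1 h, sum_add_distrib, sum_sub_distrib,
      ← sum_div, ← mul_sum]
    have h2 : ∑ h : ZMod q, (h.val : ℂ) * w ^ h.val = ∑ h ∈ range q, h * w ^ h := by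
      rw [← sum_range_natCast_zmod]
      exact sum_congr rfl fun h hh => by rw [val_cast_of_lt (mem_range.mp hh)]
    have h3 : ∑ h : ZMod q, w ^ h.val = ∑ h ∈ range q, w ^ h := by
      rw [← sum_range_natCast_zmod]
      exact sum_congr rfl fun h hh => by rw [val_cast_of_lt (mem_range.mp hh)]
    rw [h2, h3, hgeom]
    simp
  have hexp : Complex.exp (2 * Complex.I * (π * (r.val / q : ℝ))) = w := by
    rw [hw, stdAddChar_apply, toCircle_apply]
    congr 1
    push_cast
    ring
  have hw1' : w - 1 ≠ 0 := sub_ne_zero.mpr hw1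
  have hw1'' : 1 - w ≠ 0 := sub_ne_zero.mpr hw1.symm
  rw [hD, Complex.cot_eq_exp_ratio, hexp, eq_div_of_mul_eq hw1' ((mul_comm _ _).trans hS)]
  have hI := Complex.I_ne_zero
  field_simp
  ring

/-- Special values of the `L`-function of a function on `ℤ/q` of the same parity as `m`. -/
theorem LFunction_natCast_eq {q m : ℕ} [NeZero q] (hm : 1 ≤ m) {Φ : ZMod q → ℂ}
    (hΦ : ∀ j, Φ (-j) = (-1) ^ m * Φ j) :
    ZMod.LFunction Φ m = -(-(2 * π * Complex.I)) ^ m / (2 * m.factorial * q) *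
      ∑ r, Φ r * bernoulliDFT q m r := by
  have hq : (q : ℂ) ≠ 0 := NeZero.ne _
  rcases hm.eq_or_lt with rfl | hm
  -- For m = 1 both sides are the same cotangent sum; the residue r = 0 is harmless because Φ is
  -- odd.
  · have hodd : Φ.Odd := fun j => by rw [hΦ]; ring
    rw [Nat.cast_one, LFunction_def_odd hodd, Complex.cpow_neg_one, mul_sum, mul_sum]
    refine sum_congr rfl fun r _ => ?_
    by_cases hr : r = 0
    · have : Φ 0 = 0 := self_eq_neg.mp (by simpa using hodd 0)
      simp [hr, this]
    · have hIoo : ((r.val : ℝ) / q) ∈ Set.Ioo (0 : ℝ) 1 := by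
        refine ⟨?_, (val_div_mem_Ico r).2⟩
        have h1 : (0 : ℝ) < q := by exact_mod_cast NeZero.pos q
        have h2 : (0 : ℝ) < r.val := by
          exact_mod_cast Nat.pos_of_ne_zero (by simpa using hr)
        positivity
      rw [toAddCircle_apply, hurwitzZetaOdd_one hIoo, bernoulliDFT_one hr, Nat.factorial_one]
      have hI := Complex.I_sq
      push_cast
      field_simp
      linear_combination (Φ r * Complex.cot (π * r.val / q)) * hI
  -- For m ≥ 2, Φ is the transform of Ψ, which inherits its parity.
  · set Ψ := 𝓕⁻ Φ with hΨdef
    have hΨ : ∀ j, Ψ j = (q : ℂ)⁻¹ * ∑ r, stdAddChar (r * j) * Φ r := fun j => by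
      rw [hΨdef, invDFT_apply]
      simp only [smul_eq_mul]
    have hΨneg : ∀ j, Ψ (-j) = (-1) ^ m * Ψ j := by
      intro j
      rw [hΨ, hΨ, ← Equiv.sum_comp (Equiv.neg _), mul_left_comm]
      congr 1
      rw [mul_sum]
      refine sum_congr rfl fun r _ => ?_
      rw [Equiv.neg_apply, hΦ, neg_mul_neg]
      ring
    have hFΨ : 𝓕 Ψ = Φ := LinearEquiv.apply_symm_apply _ _
    rw [← hFΨ, LFunction_dft_of_two_le hm hΨneg, hFΨ]
    have : ∑ j, Ψ j * (bernoulliZMod q m j : ℂ) = (q : ℂ)⁻¹ * ∑ r, Φ r * bernoulliDFT q m r := by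
      simp only [hΨ, bernoulliDFT, mul_sum, sum_mul]
      rw [sum_comm]
      refine sum_congr rfl fun r _ => sum_congr rfl fun j _ => ?_
      rw [mul_comm r j]
      ring
    rw [this, neg_pow (2 * π * Complex.I)]
    field_simp

theorem bernoulliDFT_neg {q : ℕ} [NeZero q] (k : ℕ) (r : ZMod q) :
    bernoulliDFT q k (-r) = (-1) ^ k * bernoulliDFT q k r := by
  rw [bernoulliDFT, bernoulliDFT, ← Equiv.sum_comp (Equiv.neg _), mul_sum]
  refine sum_congr rfl fun h _ => ?_
  rw [Equiv.neg_apply, neg_mul_neg, bernoulliZMod_neg]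
  push_cast
  ring

end

/-! ### Orthogonality of characters and reduction to Dedekind sums. -/

section

open Finset ZMod
open scoped Real

theorem sum_units_eq_sum_zmod {M : Type*} [AddCommMonoid M] {q : ℕ} [NeZero q] {f : ZMod q → M}
    (hf : ∀ r, ¬ IsUnit r → f r = 0) : ∑ u : (ZMod q)ˣ, f u = ∑ r, f r := by
  refine Finset.sum_of_injOn (fun u : (ZMod q)ˣ => (u : ZMod q)) Units.val_injective.injOn
    (by simp) ?_ (by simp)
  intro r _ hr
  refine hf r fun ⟨u, hu⟩ => hr ?_
  exact ⟨u, by simp, hu⟩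

theorem sum_range_filter_dvd {M : Type*} [AddCommMonoid M] (f : ℕ → M) {q e : ℕ} (he : 0 < e)
    (heq : e ∣ q) : ∑ t ∈ range q with e ∣ t, f t = ∑ s ∈ range (q / e), f (e * s) := by
  obtain ⟨d, rfl⟩ := heq
  rw [Nat.mul_div_cancel_left _ he]
  symm
  refine sum_nbij' (fun s => e * s) (fun t => t / e) ?_ ?_ ?_ ?_ ?_
  · intro s hs
    simpa [he] using hs
  · intro t ht
    rw [mem_filter, mem_range] at ht
    exact mem_range.mpr (Nat.div_lt_of_lt_mul ht.1)
  · intro s _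
    exact Nat.mul_div_cancel_left _ he
  · intro t ht
    exact Nat.mul_div_cancel' (mem_filter.mp ht).2
  · simp

/-- ∑_{e ∣ gcd(t, q)} μ(e) detects coprimality; the multiples of e = q/d modulo q are es with s
modulo d. -/
theorem sum_units_eq_sum_moebius {q : ℕ} [NeZero q] (f : ZMod q → ℂ) :
    ∑ u : (ZMod q)ˣ, f u = ∑ d ∈ q.divisors, (ArithmeticFunction.moebius (q / d) : ℂ) *
      ∑ s ∈ range d, f ((q / d : ℕ) * s) := by
  have hq : q ≠ 0 := NeZero.ne q
  classical
  have h1 : ∑ u : (ZMod q)ˣ, f u = ∑ t ∈ range q, if t.Coprime q then f t else 0 := by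
    have := sum_units_eq_sum_zmod (f := fun r : ZMod q => if IsUnit r then f r else 0)
      (fun r hr => if_neg hr)
    simp only [Units.isUnit, if_true] at this
    rw [this, ← sum_range_natCast_zmod]
    simp only [ZMod.isUnit_iff_coprime]
  have h2 : ∀ t ∈ range q, (if t.Coprime q then f t else 0) =
      ∑ e ∈ q.divisors, if e ∣ t then (ArithmeticFunction.moebius e : ℂ) * f t else 0 := by
    intro t _
    have h := congrArg (fun g => g (t.gcd q)) ArithmeticFunction.moebius_mul_coe_zeta
    rw [ArithmeticFunction.coe_mul_zeta_apply, ArithmeticFunction.one_apply] at h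
    have h' := congrArg (Int.cast : ℤ → ℂ) h
    push_cast at h'
    rw [← sum_filter, ← sum_mul]
    have hdiv : q.divisors.filter (· ∣ t) = (t.gcd q).divisors := by
      ext e
      simp only [mem_filter, Nat.mem_divisors, Nat.dvd_gcd_iff]
      have : t.gcd q ≠ 0 := Nat.gcd_ne_zero_right hq
      tauto
    rw [hdiv, h']
    unfold Nat.Coprime
    split_ifs <;> simp
  rw [h1, sum_congr rfl h2, sum_comm, ← Nat.sum_div_divisors]
  refine sum_congr rfl fun d hd => ?_
  have hdq := Nat.dvd_of_mem_divisors hd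
  have hd0 := Nat.pos_of_mem_divisors hd
  rw [← sum_filter, ← mul_sum, sum_range_filter_dvd _
    (Nat.div_pos (Nat.le_of_dvd (Nat.pos_of_ne_zero hq) hdq) hd0) (Nat.div_dvd_of_dvd hdq),
    Nat.div_div_self hdq hq]
  push_cast
  rfl

theorem sum_range_mul_eq {M : Type*} [AddCommMonoid M] (d e : ℕ) (hd : 0 < d) (f : ℕ → M) :
    ∑ h ∈ range (d * e), f h = ∑ c ∈ range d, ∑ t ∈ range e, f (c + d * t) := by
  rw [← sum_product']
  refine sum_nbij' (fun h => (h % d, h / d)) (fun p => p.1 + d * p.2) ?_ ?_ ?_ ?_ ?_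
  · intro h hh
    rw [mem_range] at hh
    simp only [mem_product, mem_range]
    exact ⟨Nat.mod_lt _ hd, Nat.div_lt_of_lt_mul hh⟩
  · rintro ⟨c, t⟩ h
    simp only [mem_product, mem_range] at h ⊢
    calc c + d * t < d + d * t := by omega
      _ = d * (t + 1) := by ring
      _ ≤ d * e := Nat.mul_le_mul_left _ h.2
  · intro h _
    exact Nat.mod_add_div h d
  · rintro ⟨c, t⟩ h
    simp only [mem_product, mem_range] at h
    simp only [Nat.add_mul_mod_self_left, Nat.mod_eq_of_lt h.1, Nat.add_mul_div_left _ _ hd,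
      Nat.div_eq_of_lt h.1, zero_add]
  · intro h _
    simp only [Nat.mod_add_div]

theorem stdAddChar_natCast_mul {d e : ℕ} [NeZero d] [NeZero (d * e)] (h s : ℕ) (he : e ≠ 0) :
    stdAddChar ((h : ZMod (d * e)) * ((e : ZMod (d * e)) * (s : ZMod (d * e)))) =
      stdAddChar ((h : ZMod d) * (s : ZMod d)) := by
  have h1 := stdAddChar_coe (N := d * e) ((h * (e * s) : ℕ) : ℤ)
  have h2 := stdAddChar_coe (N := d) ((h * s : ℕ) : ℤ)
  push_cast at h1 h2
  rw [h1, h2]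
  congr 1
  have hd : (d : ℂ) ≠ 0 := NeZero.ne _
  have he' : (e : ℂ) ≠ 0 := by exact_mod_cast he
  field_simp

/-- Writing h = c + dt, the additive character depends on c alone, and the sum over t is an instance
of the multiplication theorem. -/
theorem bernoulliDFT_mul {d e : ℕ} [NeZero d] [NeZero e] [NeZero (d * e)] (k s : ℕ) :
    bernoulliDFT (d * e) k ((e : ℕ) * s) = (e : ℂ) / e ^ k * bernoulliDFT d k s := by
  rw [bernoulliDFT, bernoulliDFT, ← sum_range_natCast_zmod, ← sum_range_natCast_zmod,
    sum_range_mul_eq d e (NeZero.pos d), mul_sum]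
  refine sum_congr rfl fun c _ => ?_
  have hd : (d : ℝ) ≠ 0 := NeZero.ne _
  have he : (e : ℝ) ≠ 0 := NeZero.ne _
  have h1 : ∀ t ∈ range e, stdAddChar (((c + d * t : ℕ) : ZMod (d * e)) *
      ((e : ZMod (d * e)) * (s : ZMod (d * e)))) * (bernoulliZMod (d * e) k ((c + d * t : ℕ) : ZMod (d * e)) : ℂ) =
      stdAddChar ((c : ZMod d) * (s : ZMod d)) * (bernoulliBar k ((c : ℝ) / (d * e) + t / e) : ℂ) := by
    intro t _
    have h2 := bernoulliZMod_intCast (q := d * e) k ((c + d * t : ℕ) : ℤ)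
    rw [Int.cast_natCast] at h2
    rw [stdAddChar_natCast_mul _ _ (NeZero.ne e), h2]
    congr 3
    · simp
    · push_cast
      field_simp
  have h3 := sum_normBernoulliBar_add_div k e ((c : ℝ) / (d * e))
  have h4 : (e : ℝ) * (c / (d * e)) = c / d := by field_simp
  have h5 := bernoulliZMod_intCast (q := d) k (c : ℤ)
  rw [Int.cast_natCast, Int.cast_natCast] at h5
  rw [sum_congr rfl h1, ← mul_sum, h5]
  have h6 : ∑ t ∈ range e, bernoulliBar k ((c : ℝ) / (d * e) + t / e) =
      e / e ^ k * bernoulliBar k (c / d) := by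
    simp only [bernoulliBar_eq_factorial_mul]
    rw [← mul_sum, h3, h4]
    ring
  have h7 := congrArg (Complex.ofReal) h6
  push_cast at h7
  rw [h7]
  ring

/-- Parseval: summing over s forces h = -ah', and the parity of B̄_m turns the minus sign into
(-1)^m. -/
theorem sum_bernoulliDFT_mul {d : ℕ} [NeZero d] (m n a : ℕ) :
    ∑ s ∈ range d, bernoulliDFT d m s * bernoulliDFT d n (a * s) =
      (((-1) ^ m * d * (m.factorial * n.factorial * dedekindSum m n a d) : ℝ) : ℂ) := by
  rw [sum_range_natCast_zmod d (fun s => bernoulliDFT d m s * bernoulliDFT d n (a * s))]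
  have h1 : ∀ s : ZMod d, bernoulliDFT d m s * bernoulliDFT d n (a * s) =
      ∑ h' : ZMod d, ∑ h : ZMod d, (bernoulliZMod d m h : ℂ) * bernoulliZMod d n h' *
        stdAddChar (s * (h + (a : ZMod d) * h')) := by
    intro s
    rw [bernoulliDFT, bernoulliDFT, sum_mul_sum, sum_comm]
    refine sum_congr rfl fun h' _ => sum_congr rfl fun h _ => ?_
    rw [show s * (h + a * h') = h * s + h' * (a * s) by ring, AddChar.map_add_eq_mul]
    ring
  have h2 : ∀ t : ZMod d, ∑ s : ZMod d, stdAddChar (s * t) = if t = 0 then (d : ℂ) else 0 := by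
    intro t
    have := AddChar.sum_mulShift t (isPrimitive_stdAddChar d)
    rw [this, ZMod.card]
    split_ifs <;> simp
  rw [sum_congr rfl fun s _ => h1 s, sum_comm]
  have h3 : ∀ h' : ZMod d, ∑ s : ZMod d, ∑ h : ZMod d, (bernoulliZMod d m h : ℂ) *
      bernoulliZMod d n h' * stdAddChar (s * (h + (a : ZMod d) * h')) =
      (-1) ^ m * d * (bernoulliZMod d m (a * h') * bernoulliZMod d n h') := by
    intro h'
    rw [sum_comm]
    simp_rw [← mul_sum, h2, add_eq_zero_iff_eq_neg]
    rw [Finset.sum_eq_single (-(a * h'))]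
    · rw [if_pos rfl, bernoulliZMod_neg]
      push_cast
      ring
    · intro h _ hne
      rw [if_neg hne, mul_zero]
    · simp
  rw [sum_congr rfl fun h' _ => h3 h', ← sum_range_natCast_zmod, dedekindSum]
  push_cast
  rw [mul_sum, mul_sum]
  refine sum_congr rfl fun c _ => ?_
  have h4 := bernoulliZMod_intCast (q := d) m ((a * c : ℕ) : ℤ)
  have h5 := bernoulliZMod_intCast (q := d) n (c : ℤ)
  push_cast at h4 h5
  rw [h4, h5, bernoulliBar_eq_factorial_mul, bernoulliBar_eq_factorial_mul, mul_div_assoc]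
  push_cast
  ring

theorem sum_units_bernoulliDFT_mul {q : ℕ} [NeZero q] (m n a : ℕ) :
    ∑ u : (ZMod q)ˣ, bernoulliDFT q m u * bernoulliDFT q n (a * u) =
      (((-1) ^ m * q ^ 2 / q ^ (m + n) * (m.factorial * n.factorial * ∑ d ∈ q.divisors,
      (ArithmeticFunction.moebius (q / d) : ℝ) *
        ((d : ℝ) ^ (m + n) / d * dedekindSum m n a d)) : ℝ) : ℂ) := by
  rw [sum_units_eq_sum_moebius (fun r => bernoulliDFT q m r * bernoulliDFT q n (a * r))]
  push_cast
  rw [mul_sum, mul_sum]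
  refine sum_congr rfl fun d hd => ?_
  obtain ⟨e, rfl⟩ := Nat.dvd_of_mem_divisors hd
  have hd0 := Nat.pos_of_mem_divisors hd
  have : NeZero d := ⟨hd0.ne'⟩
  have : NeZero e := ⟨fun h => NeZero.ne (d * e) (by rw [h, mul_zero])⟩
  have hdC : (d : ℂ) ≠ 0 := NeZero.ne _
  have heC : (e : ℂ) ≠ 0 := NeZero.ne _
  rw [Nat.mul_div_cancel_left _ hd0]
  have h1 : ∀ s ∈ range d, bernoulliDFT (d * e) m ((e : ℕ) * s) *
      bernoulliDFT (d * e) n (a * ((e : ℕ) * s)) =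
      (e : ℂ) / e ^ m * (e / e ^ n) * (bernoulliDFT d m s * bernoulliDFT d n (a * s)) := by
    intro s _
    have := bernoulliDFT_mul (d := d) (e := e) n (a * s)
    push_cast at this
    rw [mul_left_comm (a : ZMod (d * e)), this, bernoulliDFT_mul]
    ring
  rw [sum_congr rfl h1, ← mul_sum, sum_bernoulliDFT_mul]
  push_cast
  rw [mul_pow, mul_pow, pow_add (e : ℂ)]
  field_simp

/-- Expanding both sums over units u and v, orthogonality of characters keeps only v = au. -/
theorem sum_dirichletCharacter_mul_star {q : ℕ} [NeZero q] (f g : ZMod q → ℂ) (a : (ZMod q)ˣ) :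
    ∑ χ : DirichletCharacter ℂ q, χ a * (∑ r, χ r * f r) * (∑ r, (star χ) r * g r) =
      q.totient * ∑ u : (ZMod q)ˣ, f u * g (a * u) := by
  have h1 : ∀ (χ : DirichletCharacter ℂ q) (f : ZMod q → ℂ), ∑ r, χ r * f r =
      ∑ u : (ZMod q)ˣ, χ u * f u := fun χ f =>
    (sum_units_eq_sum_zmod (f := fun r => χ r * f r)
      fun r hr => by rw [χ.map_nonunit hr, zero_mul]).symm
  have h2 : ∀ χ : DirichletCharacter ℂ q, χ a * (∑ r, χ r * f r) * (∑ r, (star χ) r * g r) =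
      ∑ u : (ZMod q)ˣ, ∑ v : (ZMod q)ˣ, f u * g v * χ ((a * u * v⁻¹ : (ZMod q)ˣ) : ZMod q) := by
    intro χ
    rw [h1, h1, mul_assoc, sum_mul_sum, mul_sum]
    refine sum_congr rfl fun u _ => ?_
    rw [mul_sum]
    refine sum_congr rfl fun v _ => ?_
    have : (star χ) (v : ZMod q) = χ ((v⁻¹ : (ZMod q)ˣ) : ZMod q) := by
      rw [MulChar.star_eq_inv, MulChar.inv_apply, Ring.inverse_unit]
    rw [this]
    push_cast
    rw [map_mul, map_mul]
    ring
  simp_rw [h2]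
  rw [sum_comm, mul_sum]
  refine sum_congr rfl fun u _ => ?_
  rw [sum_comm]
  simp_rw [← mul_sum, DirichletCharacter.sum_characters_eq]
  rw [Finset.sum_eq_single (a * u)]
  · rw [mul_inv_cancel, if_pos Units.val_one]
    push_cast
    ring
  · intro v _ hv
    rw [if_neg, mul_zero]
    intro h
    rw [Units.val_eq_one, mul_inv_eq_one] at h
    exact hv h.symm
  · simp

/-- The summand is odd under r ↦ -r. This is what removes the parity condition on χ from the mean.
-/
theorem sum_mul_bernoulliDFT_eq_zero {q : ℕ} [NeZero q] (k : ℕ) (χ : DirichletCharacter ℂ q)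
    (h : χ (-1) ≠ (-1) ^ k) : ∑ r, χ r * bernoulliDFT q k r = 0 := by
  have hs : χ (-1) * (-1) ^ k = -1 := by
    have h2 : χ (-1) * χ (-1) = 1 := by rw [← map_mul]; simp
    rcases mul_self_eq_one_iff.mp h2 with h3 | h3 <;> rcases neg_one_pow_eq_or ℂ k with h4 | h4
    · exact absurd (h3.trans h4.symm) h
    · rw [h3, h4]; ring
    · rw [h3, h4]; ring
    · exact absurd (h3.trans h4.symm) h
  rw [← self_eq_neg, ← neg_one_mul, ← hs, ← Equiv.sum_comp (Equiv.neg _), mul_sum,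
    ← Equiv.sum_comp (Equiv.neg _)]
  refine sum_congr rfl fun r _ => ?_
  simp only [Equiv.neg_apply, neg_neg]
  rw [bernoulliDFT_neg, neg_eq_neg_one_mul r, map_mul]
  have h5 : χ (-1) * χ (-1) = 1 := by rw [← map_mul]; simp
  have h6 : ((-1 : ℂ) ^ k) * (-1) ^ k = 1 := by rw [← mul_pow]; simp
  linear_combination (-χ r * bernoulliDFT q k r) * ((-1) ^ k * (-1) ^ k * h5 + h6)

theorem star_apply_neg_one {q : ℕ} (χ : DirichletCharacter ℂ q) : (star χ) (-1) = χ (-1) := by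
  have h2 : χ (-1) * χ (-1) = 1 := by rw [← map_mul]; simp
  rw [MulChar.star_apply]
  rcases mul_self_eq_one_iff.mp h2 with h3 | h3 <;> rw [h3] <;> simp

theorem LFunction_eq_of_parity {q m : ℕ} [NeZero q] (hm : 1 ≤ m) {χ : DirichletCharacter ℂ q}
    (hχ : χ (-1) = (-1) ^ m) : DirichletCharacter.LFunction χ m =
      -(-(2 * π * Complex.I)) ^ m / (2 * m.factorial * q) * ∑ r, χ r * bernoulliDFT q m r :=
  LFunction_natCast_eq hm fun j => by rw [neg_eq_neg_one_mul, map_mul, hχ]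

theorem characterMean_eq {q m n a : ℕ} [NeZero q] (hm : 1 ≤ m) (hn : 1 ≤ n)
    (haq : Nat.Coprime a q) : characterMean q m n (a : ℤ) 1 =
      (-(2 * π * Complex.I)) ^ m * (-(2 * π * Complex.I)) ^ n /
        (4 * m.factorial * n.factorial * q ^ 2) *
        (q.totient * ∑ u : (ZMod q)ˣ, bernoulliDFT q m u * bernoulliDFT q n (a * u)) := by
  have h := sum_dirichletCharacter_mul_star (bernoulliDFT q m) (bernoulliDFT q n)
    (ZMod.unitOfCoprime a haq)
  rw [ZMod.coe_unitOfCoprime] at h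
  rw [← h, characterMean, mul_sum, sum_filter]
  refine sum_congr rfl fun χ _ => ?_
  split_ifs with hχ
  · rw [LFunction_eq_of_parity hm hχ.1,
      LFunction_eq_of_parity hn ((star_apply_neg_one χ).trans hχ.2)]
    have : (star χ) ((1 : ℤ) : ZMod q) = 1 := by simp
    rw [this]
    push_cast
    field_simp
    ring
  · rcases not_and_or.mp hχ with h1 | h1
    · rw [sum_mul_bernoulliDFT_eq_zero m χ h1]
      ring
    · rw [sum_mul_bernoulliDFT_eq_zero n (star χ) (by rwa [star_apply_neg_one])]
      ring

/-- The principal branch log(-1) = πi gives the power the intended meaning e^{πi(m-n)/2}, also for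
odd m - n. -/
theorem neg_one_cpow_sub_div_two (m n : ℕ) :
    (-1 : ℂ) ^ (((m : ℂ) - n) / 2) = Complex.I ^ m * (-Complex.I) ^ n := by
  rw [Complex.cpow_def_of_ne_zero (by norm_num), Complex.log_neg_one,
    show π * Complex.I * (((m : ℂ) - n) / 2) = m * (π / 2 * Complex.I) + n * (-π / 2 * Complex.I) by
      ring, Complex.exp_add, Complex.exp_nat_mul, Complex.exp_nat_mul, Complex.exp_pi_div_two_mul_I,
    Complex.exp_neg_pi_div_two_mul_I]

end

theorem corollary2p2 (q m n a : ℕ) [NeZero q] (hq : 2 ≤ q) (hm : 1 ≤ m) (hn : 1 ≤ n) (ha : 1 ≤ a)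
    (haq : Nat.Coprime a q) :
    characterMean q m n (a : ℤ) 1 =
      (-1 : ℂ) ^ (((m : ℂ) - (n : ℂ)) / 2) * (2 * (Real.pi : ℂ)) ^ (m + n) * (Nat.totient q : ℂ) /
          (4 * (q : ℂ) ^ (m + n) * (Nat.factorial m : ℂ) * (Nat.factorial n : ℂ)) *
        (((n : ℝ) * ∑ j ∈ Finset.Icc 1 m,
              (Nat.choose m j : ℝ) * ((-1 : ℝ) ^ j * (a : ℝ) ^ (m - j) / ((m : ℝ) + n - j)) *
                bernoulliBar j 0 * bernoulliBar (m + n - j) 0 * jordanTotient j q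
          + (m : ℝ) * (a : ℝ) ^ (m - 1) * ∑ j ∈ Finset.Icc 1 n,
              (Nat.choose n j : ℝ) * ((-1 : ℝ) ^ j / ((m : ℝ) + n - j)) *
                ∑ l ∈ Finset.Icc 1 a, bernoulliBar j ((l : ℝ) / a) *
                  ∑ d ∈ q.divisors, (ArithmeticFunction.moebius (q / d) : ℝ) * (d : ℝ) ^ j *
                    bernoulliBar (m + n - j) ((d : ℝ) * l / a)
          + (-1 : ℝ) ^ (n - 1) * (Nat.factorial m : ℝ) * (Nat.factorial n : ℝ) *
              (bernoulli (m + n) : ℝ) * jordanTotient (m + n) q /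
                ((a : ℝ) ^ n * (Nat.factorial (m + n) : ℝ))
          - (if m = 1 ∧ n = 1 then 1 else 0) * (Nat.totient q : ℝ) / 4 : ℝ) : ℂ) := by
  rw [← sum_moebius_mul_dedekindSum hq hm hn ha haq, characterMean_eq hm hn haq,
    sum_units_bernoulliDFT_mul, neg_one_cpow_sub_div_two, Complex.ofReal_mul]
  have hq0 : (q : ℂ) ≠ 0 := NeZero.ne _
  generalize ((m.factorial * n.factorial * ∑ d ∈ q.divisors,
    (ArithmeticFunction.moebius (q / d) : ℝ) *
      ((d : ℝ) ^ (m + n) / d * dedekindSum m n a d) : ℝ) : ℂ) = B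
  -- The (-1)^m from Parseval changes (-2πi)^m into (2πi)^m, leaving i^m(-i)^n as the phase.
  have hI : (-(2 * Real.pi * Complex.I)) ^ m * (-1) ^ m = (2 * (Real.pi : ℂ)) ^ m * Complex.I ^ m := by
    rw [← mul_pow, ← mul_pow]
    ring
  have hI' : (-(2 * Real.pi * Complex.I)) ^ n = (2 * (Real.pi : ℂ)) ^ n * (-Complex.I) ^ n := by
    rw [← mul_pow]
    ring
  push_cast
  rw [hI', pow_add (2 * (Real.pi : ℂ))]
  generalize (-(2 * Real.pi * Complex.I)) ^ m = X, (2 * (Real.pi : ℂ)) ^ m = Y, (2 * (Real.pi : ℂ)) ^ n = Z,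
    (-Complex.I) ^ n = W at hI ⊢
  field_simp
  linear_combination (Z * W * q.totient * B * (m.factorial : ℂ)⁻¹ * (n.factorial : ℂ)⁻¹) * hI
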